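/- Let $d\ge 1$, let $\Omega\subset\mathbb R^d$ be a compact set with $\Omega=\overline{\operatorname{int}\Omega}$ whose interior is a bounded Lipschitz domain (connected, open, with boundary that is locally, in suitable orthogonal coordinates, the graph of a Lipschitz function with the domain on one side of it). Let $w:\Omega\to[0,\infty)$ be continuous, let $1<\alpha<\frac{d}{d-1}$ (just $1<\alpha<\infty$ if $d=1$), let $\alpha'=\frac{\alpha}{\alpha-1}$, and let $\mu^+,\mu^-$ be Borel probability measures on $\Omega$; put $\mu=\mu^+-\mu^-$. Write $W^{1,p}=W^{1,p}(\operatorname{int}\Omega)$ and $W^{1,p}_\emptyset=\{v\in W^{1,p}:\int_\Omega v\,dx=0\}$. Assume that the Neumann–Poisson problem on $\Omega$ is uniquely solvable: for every $\nu$ in the topological dual $(W^{1,\alpha})^*$ with $\langle\nu,1\rangle=0$ there is exactly one $y\in W^{1,\alpha'}_\emptyset$ with $$-\int_\Omega\nabla y\cdot\nabla\varphi\,dx=\langle\nu,\varphi\rangle\qquad\text{for all }\varphi\in W^{1,\alpha}_\emptyset .$$ Then for every $\varepsilon>0$ the regularized Beckmann problem $$\min\Big\{\int_\Omega w\,|q|\,dx+\frac{\varepsilon}{\alpha}\,\|q\|_{L^\alpha}^{\alpha}\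 :\ q\in L^\alpha(\Omega;\mathbb R^d),\ \operatorname{div}q=\mu\Big\}$$ has exactly one solution (minimizer). Here $|\cdot|$ is the Euclidean norm, and $\operatorname{div}q=\mu$ means that $$-\int_\Omega q\cdot\nabla\varphi\,dx=\int_\Omega\varphi\,d\mu^+-\int_\Omega\varphi\,d\mu^-\qquad\text{for all }\varphi\in W^{1,\alpha'}_\emptyset,$$ where on the right-hand side $\varphi$ stands for its representative in $C(\Omega)$, which exists by the Sobolev embedding because $\alpha'>d$. -/

import Mathlib

open MeasureTheory Set
open scoped ENNReal ContDiff

noncomputable section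

/-- Euclidean space of dimension `d`. -/
abbrev Euc (d : ℕ) : Type := EuclideanSpace ℝ (Fin d)

/-! ### Lipschitz domains -/

/-- A Lipschitz domain in the sense of Grisvard: a (nonempty) connected open set `U` such that every
boundary point has a neighbourhood which, in suitable new orthogonal coordinates `T`, is a box
`{|y_j| < a_j}`, in which `U` is the strict subgraph `y_i < ψ(y')` and the boundary of `U` the graph
`y_i = ψ(y')` of a Lipschitz function `ψ`, defined on the box of the remaining coordinates `y'` and
bounded by `a_i / 2` there. The coordinate `i` plays the role of the last one. -/
structure IsLipschitzDomain {d : ℕ} (U : Set (Euc d)) : Prop where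
  isOpen : IsOpen U
  isConnected : IsConnected U
  boundary : ∀ x ∈ frontier U, ∃ (T : Euc d ≃ᵃⁱ[ℝ] Euc d) (i : Fin d) (a : Fin d → ℝ)
    (ψ : EuclideanSpace ℝ {j : Fin d // j ≠ i} → ℝ) (K : NNReal),
    (∀ j, 0 < a j) ∧ (∀ j, |T x j| < a j) ∧
    LipschitzOnWith K ψ {z | ∀ j, |z j| < a j} ∧
    (∀ z : EuclideanSpace ℝ {j : Fin d // j ≠ i}, (∀ j, |z j| < a j) → |ψ z| ≤ a i / 2) ∧
    (∀ y : Euc d, (∀ j, |T y j| < a j) →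
      (y ∈ U ↔ T y i < ψ (WithLp.toLp 2 fun j => T y j)) ∧
      (y ∈ frontier U ↔ T y i = ψ (WithLp.toLp 2 fun j => T y j)))

/-! ### Sobolev spaces -/

/-- `g` is a weak gradient of `u` on `U`: `∫_U u ∇φ = - ∫_U φ g` for all `φ ∈ C_c^∞(U)`. -/
def HasWeakGradient {d : ℕ} (U : Set (Euc d)) (u : Euc d → ℝ) (g : Euc d → Euc d) : Prop :=
  ∀ φ : Euc d → ℝ, ContDiff ℝ ∞ φ → HasCompactSupport φ → tsupport φ ⊆ U →
    ∫ x in U, u x • gradient φ x = - ∫ x in U, φ x • g x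

theorem integrable_smul_testGradient {d : ℕ} {U : Set (Euc d)} {p : ℝ≥0∞} [hp : Fact (1 ≤ p)]
    (u : Lp ℝ p (volume.restrict U)) {φ : Euc d → ℝ} (hφ : ContDiff ℝ ∞ φ)
    (hc : HasCompactSupport φ) :
    Integrable (fun x => u x • gradient φ x) (volume.restrict U) := by
  have hcont : Continuous (gradient φ) :=
    (InnerProductSpace.toDual ℝ (Euc d)).symm.continuous.comp (hφ.continuous_fderiv (by simp))
  have hcs : HasCompactSupport (gradient φ) :=
    (hc.fderiv (𝕜 := ℝ)).comp_left (g := (InnerProductSpace.toDual ℝ (Euc d)).symm) (map_zero _)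
  exact ((Lp.memLp u).locallyIntegrable hp.out).integrable_smul_right_of_hasCompactSupport hcont hcs

theorem integrable_testFunction_smul {d : ℕ} {U : Set (Euc d)} {p : ℝ≥0∞} [hp : Fact (1 ≤ p)]
    (g : Lp (Euc d) p (volume.restrict U)) {φ : Euc d → ℝ} (hφ : ContDiff ℝ ∞ φ)
    (hc : HasCompactSupport φ) :
    Integrable (fun x => φ x • g x) (volume.restrict U) :=
  ((Lp.memLp g).locallyIntegrable hp.out).integrable_smul_left_of_hasCompactSupport
    hφ.continuous hc

/-- The subspace of `L^p(U) × L^p(U; ℝ^d)` of all pairs `(u, ∇u)`, where `∇u` is the weak gradient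
of `u`. -/
def sobolevSubmodule {d : ℕ} (p : ℝ≥0∞) [Fact (1 ≤ p)] (U : Set (Euc d)) :
    Submodule ℝ (Lp ℝ p (volume.restrict U) × Lp (Euc d) p (volume.restrict U)) where
  carrier := {v | HasWeakGradient U v.1 v.2}
  zero_mem' := by
    intro φ hφ hc hU
    have h1 : ∫ x in U, (0 : Lp ℝ p (volume.restrict U)) x • gradient φ x = 0 := by
      rw [integral_eq_zero_of_ae]
      filter_upwards [Lp.coeFn_zero ℝ p (volume.restrict U)] with x hx
      rw [hx, Pi.zero_apply, Pi.zero_apply, zero_smul]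
    have h2 : ∫ x in U, φ x • (0 : Lp (Euc d) p (volume.restrict U)) x = 0 := by
      rw [integral_eq_zero_of_ae]
      filter_upwards [Lp.coeFn_zero (Euc d) p (volume.restrict U)] with x hx
      simp only [hx, Pi.zero_apply, smul_zero]
    simp only [Prod.fst_zero, Prod.snd_zero, h1, h2, neg_zero]
  add_mem' := by
    intro v v' hv hv' φ hφ hc hU
    have h1 : ∫ x in U, (v.1 + v'.1) x • gradient φ x =
        ∫ x in U, (v.1 x • gradient φ x + v'.1 x • gradient φ x) := by
      refine integral_congr_ae ?_
      filter_upwards [Lp.coeFn_add v.1 v'.1] with x hx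
      rw [hx, Pi.add_apply, add_smul]
    have h2 : ∫ x in U, φ x • (v.2 + v'.2) x = ∫ x in U, (φ x • v.2 x + φ x • v'.2 x) := by
      refine integral_congr_ae ?_
      filter_upwards [Lp.coeFn_add v.2 v'.2] with x hx
      rw [hx, Pi.add_apply, smul_add]
    rw [Prod.fst_add, Prod.snd_add, h1, h2,
      integral_add (integrable_smul_testGradient v.1 hφ hc)
        (integrable_smul_testGradient v'.1 hφ hc),
      integral_add (integrable_testFunction_smul v.2 hφ hc)
        (integrable_testFunction_smul v'.2 hφ hc), hv φ hφ hc hU, hv' φ hφ hc hU, neg_add]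
  smul_mem' := by
    intro c v hv φ hφ hc hU
    have h1 : ∫ x in U, (c • v.1) x • gradient φ x = ∫ x in U, c • (v.1 x • gradient φ x) := by
      refine integral_congr_ae ?_
      filter_upwards [Lp.coeFn_smul c v.1] with x hx
      rw [hx, Pi.smul_apply, smul_assoc]
    have h2 : ∫ x in U, φ x • (c • v.2) x = ∫ x in U, c • (φ x • v.2 x) := by
      refine integral_congr_ae ?_
      filter_upwards [Lp.coeFn_smul c v.2] with x hx
      rw [hx, Pi.smul_apply, smul_comm]
    rw [Prod.smul_fst, Prod.smul_snd, h1, h2, integral_smul, integral_smul, hv φ hφ hc hU, smul_neg]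

/-- The Sobolev space `W^{1,p}(U)`: every `u ∈ L^p(U)` that has a weak gradient in `L^p(U; ℝ^d)`,
together with that gradient (which `u` determines when `U` is open). The norm, inherited from the
product, is `max (‖u‖_p, ‖∇u‖_p)`; it is equivalent to the usual one. -/
abbrev Sobolev {d : ℕ} (p : ℝ≥0∞) [Fact (1 ≤ p)] (U : Set (Euc d)) : Type :=
  ↥(sobolevSubmodule p U)

namespace Sobolev

variable {d : ℕ} {p : ℝ≥0∞} [Fact (1 ≤ p)] {U : Set (Euc d)}

/-- The function `u ∈ L^p(U)` underlying an element of `W^{1,p}(U)`. -/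
def fn (v : Sobolev p U) : Lp ℝ p (volume.restrict U) := v.1.1

/-- The weak gradient `∇u ∈ L^p(U; ℝ^d)` of an element of `W^{1,p}(U)`. -/
def grad (v : Sobolev p U) : Lp (Euc d) p (volume.restrict U) := v.1.2

/-- Membership in the subspace `W^{1,p}_∅(U)` of functions with `∫_U u = 0`. -/
def IsMeanZero (v : Sobolev p U) : Prop := ∫ x in U, v.fn x = 0

end Sobolev

/-- The subspace of all `ν` in the topological dual `(W^{1,p}(U))^*` with `⟨ν, 1⟩ = 0`; here `1` is
the element of `W^{1,p}(U)` that is (almost everywhere) the constant function one. -/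
def dualPerp {d : ℕ} (p : ℝ≥0∞) [Fact (1 ≤ p)] (U : Set (Euc d)) :
    Set (StrongDual ℝ (Sobolev p U)) :=
  {ν | ∀ one : Sobolev p U, one.fn =ᵐ[volume.restrict U] (fun _ => 1) → ν one = 0}

/-! ### The regularized Beckmann problem -/

instance fact_one_le_ofReal {α : ℝ} [h : Fact (1 < α)] : Fact (1 ≤ ENNReal.ofReal α) :=
  ⟨by simpa using h.out.le⟩

instance fact_one_lt_conjExponent {α : ℝ} [h : Fact (1 < α)] : Fact (1 < α.conjExponent) :=
  ⟨(Real.HolderConjugate.conjExponent h.out).symm.lt⟩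

/-- Solvability of the Neumann-Poisson problem on `Ω`: for every `ν` in the dual of `W^{1,α}` with
`⟨ν, 1⟩ = 0` there is exactly one `y ∈ W^{1,α'}_∅` such that `div ∇y = ν`, that is,
`- ∫_Ω ∇y · ∇φ = ⟨ν, φ⟩` for all `φ ∈ W^{1,α}_∅`. Sobolev spaces are those on the interior. -/
def NeumannPoissonSolvable {d : ℕ} (Ω : Set (Euc d)) (α : ℝ) [Fact (1 < α)] : Prop :=
  ∀ ν ∈ dualPerp (ENNReal.ofReal α) (interior Ω),
    ∃! y : Sobolev (ENNReal.ofReal α.conjExponent) (interior Ω), y.IsMeanZero ∧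
      ∀ φ : Sobolev (ENNReal.ofReal α) (interior Ω), φ.IsMeanZero →
        - ∫ x in interior Ω, inner ℝ (y.grad x) (φ.grad x) = ν φ

/-- The vector fields `q ∈ L^α(Ω; ℝ^d)`. -/
abbrev LpField {d : ℕ} (Ω : Set (Euc d)) (α : ℝ) : Type :=
  Lp (Euc d) (ENNReal.ofReal α) (volume.restrict Ω)

/-- The constraint `div q = μ⁺ - μ⁻` in the dual of `W^{1,α'}_∅`: for every `φ ∈ W^{1,α'}_∅`,
`- ∫_Ω q · ∇φ = ∫_Ω φ dμ⁺ - ∫_Ω φ dμ⁻`. Since `μ⁺` and `μ⁻` may charge Lebesgue null sets, the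
right-hand side refers to the continuous representative `f ∈ C(Ω)` of `φ`. -/
def HasDivergence {d : ℕ} {Ω : Set (Euc d)} {α : ℝ} [Fact (1 < α)] (q : LpField Ω α)
    (μp μm : Measure (Euc d)) : Prop :=
  ∀ φ : Sobolev (ENNReal.ofReal α.conjExponent) (interior Ω), φ.IsMeanZero →
    ∀ f : Euc d → ℝ, ContinuousOn f Ω → φ.fn =ᵐ[volume.restrict (interior Ω)] f →
      - ∫ x in interior Ω, inner ℝ (q x) (φ.grad x) = (∫ x in Ω, f x ∂μp) - ∫ x in Ω, f x ∂μm

/-- The objective `∫_Ω w |q| dx + (ε / α) ‖q‖_α^α`. -/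
def beckmannObjective {d : ℕ} {Ω : Set (Euc d)} {α : ℝ} (w : Euc d → ℝ) (ε : ℝ)
    (q : LpField Ω α) : ℝ :=
  (∫ x in Ω, w x * ‖q x‖) + ε / α * ‖q‖ ^ α

/-- `q` solves the regularized Beckmann problem: it is feasible and minimizes the objective among
all feasible fields. -/
def IsBeckmannSolution {d : ℕ} {Ω : Set (Euc d)} {α : ℝ} [Fact (1 < α)] (w : Euc d → ℝ) (ε : ℝ)
    (μp μm : Measure (Euc d)) (q : LpField Ω α) : Prop :=
  HasDivergence q μp μm ∧
    ∀ q' : LpField Ω α, HasDivergence q' μp μm → beckmannObjective w ε q ≤ beckmannObjective w ε q'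

end

/-! The objective is a convex continuous term plus a multiple of `‖q‖ ^ α`, and the feasible fields
form a closed set stable under midpoints. Existence and uniqueness both come from uniform convexity.
The midpoint of two near-minimizers is feasible, so its value is at least the infimum. Hence the
convexity defect of `‖·‖ ^ α` at the pair is small, and the two fields are close in `L^α`.
Minimizing sequences are therefore Cauchy and two minimizers coincide; no weak compactness is used
(`existsUnique_minimizer_of_uniformlyConvexPow`). Uniform convexity itself is a compactness fact in
Euclidean space, put in a form that can be integrated pointwise.

The real work is to produce one feasible field (`exists_hasDivergence`). With `p = α' > d`, the
functional `φ ↦ ∫ φ dμ⁻ - ∫ φ dμ⁺` must be bounded by `‖∇φ‖_p` on mean-zero functions. Morrey's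
estimate bounds `sup |φ|` by `‖φ‖_p + ‖∇φ‖_p`; it rests on the cones that a Lipschitz domain
contains near each point of its closure. The Poincaré inequality then removes `‖φ‖_p`. It follows
from the solvability hypothesis: the weak Neumann Laplacian is a continuous bijection from mean-zero
functions onto a closed space of functionals, hence has a bounded inverse, and it factors through
the gradient.

Given the bound, the functional descends to gradients, Hahn–Banach extends it to all of `L^p(int Ω;
ℝ^d)`, and the duality of `L^p` and `L^α` represents it by a field `q`. That duality is again a
minimization: the Euler–Lagrange equation of `u ↦ ‖u‖ ^ p / p - L u` exhibits the representative. -/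

open Filter Topology

/-! ### Uniform convexity of the `p`-th power of the norm -/

/-- The `p`-th power of the norm is uniformly convex, up to an error that is a small multiple of the
sizes of the two points. -/
def UniformlyConvexPow (E : Type*) [NormedAddCommGroup E] [NormedSpace ℝ E] (p : ℝ) : Prop :=
  ∀ δ : ℝ, 0 < δ → ∃ C : ℝ, 0 ≤ C ∧ ∀ u v : E,
    ‖u - v‖ ^ p ≤ δ * (‖u‖ ^ p + ‖v‖ ^ p) +
      C * ((‖u‖ ^ p + ‖v‖ ^ p) / 2 - ‖(2⁻¹ : ℝ) • (u + v)‖ ^ p)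

theorem Lp_norm_rpow_eq_integral {E X : Type*} [NormedAddCommGroup E] [MeasurableSpace X] {μ : Measure X} {p : ℝ}
    (hp : 0 < p) (f : Lp E (ENNReal.ofReal p) μ) : ‖f‖ ^ p = ∫ x, ‖f x‖ ^ p ∂μ := by
  rw [Lp.norm_def, (Lp.memLp f).eLpNorm_eq_integral_rpow_norm (by simpa using hp)
    ENNReal.ofReal_ne_top, ENNReal.toReal_ofReal hp.le]
  have : 0 ≤ ∫ x, ‖f x‖ ^ p ∂μ := integral_nonneg fun x => by positivity
  rw [ENNReal.toReal_ofReal (by positivity), ← Real.rpow_mul this, inv_mul_cancel₀ hp.ne',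
    Real.rpow_one]

theorem Lp_integrable_norm_rpow {E X : Type*} [NormedAddCommGroup E] [MeasurableSpace X] {μ : Measure X} {p : ℝ}
    (hp : 0 < p) (f : Lp E (ENNReal.ofReal p) μ) : Integrable (fun x => ‖f x‖ ^ p) μ := by
  have := (Lp.memLp f).integrable_norm_rpow (by simpa using hp) ENNReal.ofReal_ne_top
  rwa [ENNReal.toReal_ofReal hp.le] at this

section UniformConvexity

variable {E : Type*} [NormedAddCommGroup E] [NormedSpace ℝ E]

/-- Strictness has two sources: for equal norms it is strict convexity of the unit ball, for
different norms it is strict convexity of `t ↦ t ^ p`. -/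
theorem norm_midpoint_rpow_lt [StrictConvexSpace ℝ E] {p : ℝ} (hp : 1 < p) {u v : E} (h : u ≠ v) :
    ‖(2⁻¹ : ℝ) • (u + v)‖ ^ p < (‖u‖ ^ p + ‖v‖ ^ p) / 2 := by
  have hp0 : 0 < p := by linarith
  rcases eq_or_ne ‖u‖ ‖v‖ with huv | huv
  · have h1 : ‖(2⁻¹ : ℝ) • (u + v)‖ < ‖u‖ := by
      have := (norm_midpoint_lt_iff huv).2 h
      simpa using this
    have := Real.rpow_lt_rpow (norm_nonneg _) h1 hp0
    rw [← huv]; linarith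
  · have h1 : ‖(2⁻¹ : ℝ) • (u + v)‖ ≤ (1 / 2) * ‖u‖ + (1 / 2) * ‖v‖ := by
      rw [norm_smul]
      have := norm_add_le u v
      norm_num
      linarith
    have h2 := (strictConvexOn_rpow hp).2 (norm_nonneg u) (norm_nonneg v) huv
      (by norm_num : (0 : ℝ) < 1 / 2) (by norm_num : (0 : ℝ) < 1 / 2) (by norm_num)
    simp only [smul_eq_mul] at h2
    have := Real.rpow_le_rpow (norm_nonneg _) h1 hp0.le
    linarith

/-- By homogeneity one may assume `‖u‖ ^ p + ‖v‖ ^ p = 1`. Normalized pairs with `‖u - v‖ ^ p ≥ δ`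
form a compact set on which the convexity defect is positive, so the quotient of `‖u - v‖ ^ p` by
the defect is bounded there, which gives `C`. For the other pairs the `δ` term is enough. -/
theorem uniformlyConvexPow_of_strictConvexSpace [StrictConvexSpace ℝ E] [ProperSpace E] {p : ℝ}
    (hp : 1 < p) : UniformlyConvexPow E p := by
  intro δ hδ
  have hp0 : 0 < p := by linarith
  set S : Set (E × E) := {z | ‖z.1‖ ^ p + ‖z.2‖ ^ p = 1 ∧ δ ≤ ‖z.1 - z.2‖ ^ p} with hS
  have hc1 : Continuous fun z : E × E => ‖z.1‖ ^ p + ‖z.2‖ ^ p :=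
    ((continuous_norm.comp continuous_fst).rpow_const fun _ => Or.inr hp0.le).add
      ((continuous_norm.comp continuous_snd).rpow_const fun _ => Or.inr hp0.le)
  have hc2 : Continuous fun z : E × E => ‖z.1 - z.2‖ ^ p :=
    (continuous_fst.sub continuous_snd).norm.rpow_const fun _ => Or.inr hp0.le
  have hc3 : Continuous fun z : E × E => ‖(2⁻¹ : ℝ) • (z.1 + z.2)‖ ^ p :=
    ((continuous_fst.add continuous_snd).const_smul (2⁻¹ : ℝ)).norm.rpow_const
      fun _ => Or.inr hp0.le
  have hSc : IsCompact S := by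
    refine Metric.isCompact_of_isClosed_isBounded
      ((isClosed_eq hc1 continuous_const).inter (isClosed_le continuous_const hc2)) ?_
    refine (Metric.isBounded_closedBall (x := (0 : E × E)) (r := 1)).subset ?_
    rintro z ⟨hz, -⟩
    have h1 : 0 ≤ ‖z.1‖ ^ p := by positivity
    have h2 : 0 ≤ ‖z.2‖ ^ p := by positivity
    have key : ∀ t : ℝ, 0 ≤ t → t ^ p ≤ 1 → t ≤ 1 := fun t ht h => by
      by_contra hlt
      exact absurd h (not_le.2 (Real.one_lt_rpow (not_le.1 hlt) hp0))
    rw [mem_closedBall_zero_iff, Prod.norm_def]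
    exact max_le (key _ (norm_nonneg _) (by linarith)) (key _ (norm_nonneg _) (by linarith))
  have hpos : ∀ z ∈ S, 0 < (‖z.1‖ ^ p + ‖z.2‖ ^ p) / 2 - ‖(2⁻¹ : ℝ) • (z.1 + z.2)‖ ^ p := by
    rintro z ⟨-, hz⟩
    refine sub_pos.2 (norm_midpoint_rpow_lt hp fun h => ?_)
    rw [h, sub_self, norm_zero, Real.zero_rpow hp0.ne'] at hz
    linarith
  obtain ⟨C, hC⟩ := hSc.exists_bound_of_continuousOn
    (f := fun z : E × E => ‖z.1 - z.2‖ ^ p /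
      ((‖z.1‖ ^ p + ‖z.2‖ ^ p) / 2 - ‖(2⁻¹ : ℝ) • (z.1 + z.2)‖ ^ p))
    (hc2.continuousOn.div ((hc1.div_const 2).sub hc3).continuousOn fun z hz => (hpos z hz).ne')
  refine ⟨max C 0, le_max_right _ _, fun u v => ?_⟩
  have hdef : ∀ u v : E, 0 ≤ (‖u‖ ^ p + ‖v‖ ^ p) / 2 - ‖(2⁻¹ : ℝ) • (u + v)‖ ^ p := fun u v => by
    rcases eq_or_ne u v with rfl | h
    · rw [← two_smul ℝ u, smul_smul]; norm_num
    · exact (sub_pos.2 (norm_midpoint_rpow_lt hp h)).le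
  have hunit : ∀ u v : E, ‖u‖ ^ p + ‖v‖ ^ p = 1 → ‖u - v‖ ^ p ≤ δ +
      max C 0 * ((‖u‖ ^ p + ‖v‖ ^ p) / 2 - ‖(2⁻¹ : ℝ) • (u + v)‖ ^ p) := fun u v huv => by
    have h0 := hdef u v
    have hm : 0 ≤ max C 0 := le_max_right _ _
    rcases le_total δ (‖u - v‖ ^ p) with h | h
    · have hz : (u, v) ∈ S := ⟨huv, h⟩
      have h1 := (le_abs_self _).trans (hC _ hz)
      have h2 := hpos _ hz
      simp only at h1 h2
      rw [div_le_iff₀ h2] at h1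
      have := mul_le_mul_of_nonneg_right (le_max_left C 0) h0
      linarith
    · have := mul_nonneg hm h0
      linarith
  set s := ‖u‖ ^ p + ‖v‖ ^ p with hs
  have hu0 : 0 ≤ ‖u‖ ^ p := by positivity
  have hv0 : 0 ≤ ‖v‖ ^ p := by positivity
  rcases (add_nonneg hu0 hv0).eq_or_lt' with h0 | h0
  · have hu : u = 0 := by
      have : ‖u‖ ^ p = 0 := by linarith
      rw [Real.rpow_eq_zero (norm_nonneg _) hp0.ne'] at this
      exact norm_eq_zero.1 this
    have hv : v = 0 := by
      have : ‖v‖ ^ p = 0 := by linarith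
      rw [Real.rpow_eq_zero (norm_nonneg _) hp0.ne'] at this
      exact norm_eq_zero.1 this
    simp [hs, hu, hv, Real.zero_rpow hp0.ne']
  · rw [← hs] at h0
    -- Scaling by `c` divides every `p`-th power of a norm by `s`, which normalizes the pair.
    set c : ℝ := s ^ (-p⁻¹) with hc
    have hcpos : 0 < c := Real.rpow_pos_of_pos h0 _
    have hcp : c ^ p = s⁻¹ := by
      rw [hc, ← Real.rpow_mul h0.le, neg_mul, inv_mul_cancel₀ hp0.ne', Real.rpow_neg_one]
    have hn : ∀ x : E, ‖c • x‖ ^ p = s⁻¹ * ‖x‖ ^ p := fun x => by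
      rw [norm_smul, Real.mul_rpow (norm_nonneg _) (norm_nonneg _), Real.norm_of_nonneg hcpos.le,
        hcp]
    have h := hunit (c • u) (c • v) (by rw [hn, hn, ← mul_add, ← hs, inv_mul_cancel₀ h0.ne'])
    rw [← smul_sub, ← smul_add, smul_comm, hn, hn, hn, hn, ← mul_add, ← hs] at h
    have h' := mul_le_mul_of_nonneg_left h h0.le
    have e1 : s * (s⁻¹ * ‖u - v‖ ^ p) = ‖u - v‖ ^ p := by field_simp
    have e2 : s * (δ + max C 0 * (s⁻¹ * s / 2 - s⁻¹ * ‖(2⁻¹ : ℝ) • (u + v)‖ ^ p)) =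
      δ * s + max C 0 * (s / 2 - ‖(2⁻¹ : ℝ) • (u + v)‖ ^ p) := by field_simp
    rw [e1, e2] at h'
    exact h'

/-- The defining inequality is linear in `p`-th powers of norms, so it can be applied pointwise and
integrated with the same `δ` and `C`. The additive error is there for this purpose. -/
theorem UniformlyConvexPow.lp {X : Type*} [MeasurableSpace X] {μ : Measure X} {p : ℝ}
    [Fact (1 ≤ ENNReal.ofReal p)] (hp : 0 < p) (h : UniformlyConvexPow E p) :
    UniformlyConvexPow (Lp E (ENNReal.ofReal p) μ) p := by
  intro δ hδ
  obtain ⟨C, hC0, hC⟩ := h δ hδ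
  refine ⟨C, hC0, fun u v => ?_⟩
  have iu := Lp_integrable_norm_rpow hp u
  have iv := Lp_integrable_norm_rpow hp v
  have im := Lp_integrable_norm_rpow hp ((2⁻¹ : ℝ) • (u + v))
  have is : Integrable (fun x => ‖u x‖ ^ p + ‖v x‖ ^ p) μ := iu.add iv
  have ih : Integrable (fun x => (‖u x‖ ^ p + ‖v x‖ ^ p) / 2) μ := is.div_const 2
  have id : Integrable (fun x => (‖u x‖ ^ p + ‖v x‖ ^ p) / 2 - ‖((2⁻¹ : ℝ) • (u + v)) x‖ ^ p) μ :=
    ih.sub im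
  simp only [Lp_norm_rpow_eq_integral hp]
  rw [← integral_add iu iv, ← integral_const_mul, ← integral_div, ← integral_sub ih im,
    ← integral_const_mul, ← integral_add (is.const_mul δ) (id.const_mul C)]
  refine integral_mono_ae (Lp_integrable_norm_rpow hp (u - v))
    ((is.const_mul δ).add (id.const_mul C)) ?_
  filter_upwards [Lp.coeFn_sub u v, Lp.coeFn_smul (2⁻¹ : ℝ) (u + v), Lp.coeFn_add u v]
    with x h1 h2 h3
  rw [h1, h2, Pi.smul_apply, h3]
  exact hC (u x) (v x)

end UniformConvexity

/-! ### Minimization by Cauchy sequences -/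

section Minimization

variable {E : Type*} [NormedAddCommGroup E] [NormedSpace ℝ E]

/-- Beyond the threshold `T` the factor `t ^ (p - 1)` exceeds `2 * b / c`, so the power absorbs the
linear term; below it the linear term is at most `b * T`. -/
theorem exists_mul_le_half_mul_rpow_add {p c : ℝ} (hp : 1 < p) (hc : 0 < c) (B : ℝ) :
    ∃ A : ℝ, ∀ t : ℝ, 0 ≤ t → B * t ≤ c / 2 * t ^ p + A := by
  set b := max B 0
  have hb : 0 ≤ b := le_max_right _ _
  set T : ℝ := (2 * b / c) ^ (p - 1)⁻¹ with hT
  have hT0 : 0 ≤ T := by positivity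
  refine ⟨b * T, fun t ht => ?_⟩
  have h1 : B * t ≤ b * t := mul_le_mul_of_nonneg_right (le_max_left _ _) ht
  have h2 : 0 ≤ c / 2 * t ^ p := by positivity
  rcases le_total t T with h | h
  · have := mul_le_mul_of_nonneg_left h hb
    linarith
  · have h3 : 2 * b / c ≤ t ^ (p - 1) := by
      have := Real.rpow_le_rpow hT0 h (by linarith : 0 ≤ p - 1)
      rwa [hT, ← Real.rpow_mul (by positivity), inv_mul_cancel₀ (by linarith), Real.rpow_one]
        at this
    have h4 : b * t ≤ c / 2 * t ^ p := by
      rcases ht.eq_or_lt with rfl | ht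
      · simpa using h2
      · have : t ^ p = t ^ (p - 1) * t := by
          rw [← Real.rpow_add_one ht.ne']; congr 1; ring
        rw [this, ← mul_assoc]
        refine mul_le_mul_of_nonneg_right ?_ ht.le
        rw [div_le_iff₀ hc] at h3
        linarith
    have := mul_nonneg hb hT0
    linarith

/-- Comparing the midpoint of two near-minimizers with the infimum `m` bounds their convexity
defect, hence their distance. This yields a Cauchy minimizing sequence and uniqueness at once. The
lower bound on `F` makes the functional coercive, so the near-minimizers are uniformly bounded. -/
theorem existsUnique_minimizer_of_uniformlyConvexPow [CompleteSpace E] {p : ℝ} (hp : 1 < p)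
    (hE : UniformlyConvexPow E p) {K : Set E} (hK : IsClosed K) (hne : K.Nonempty)
    (hmid : ∀ u ∈ K, ∀ v ∈ K, (2⁻¹ : ℝ) • (u + v) ∈ K) {F : E → ℝ} (hF : Continuous F)
    (hFmid : ∀ u v, F ((2⁻¹ : ℝ) • (u + v)) ≤ (F u + F v) / 2)
    {B : ℝ} (hB : ∀ u, -(B * ‖u‖) ≤ F u) {c : ℝ} (hc : 0 < c) :
    ∃! u, u ∈ K ∧ ∀ v ∈ K, F u + c * ‖u‖ ^ p ≤ F v + c * ‖v‖ ^ p := by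
  have hp0 : 0 < p := by linarith
  set J : E → ℝ := fun u => F u + c * ‖u‖ ^ p with hJ
  obtain ⟨A, hA⟩ := exists_mul_le_half_mul_rpow_add hp hc B
  have hcoer : ∀ u, c / 2 * ‖u‖ ^ p ≤ J u + A := fun u => by
    have h1 := hA ‖u‖ (norm_nonneg _)
    have h2 := hB u
    simp only [hJ]
    linarith
  have hbdd : BddBelow (J '' K) := by
    refine ⟨-A, ?_⟩
    rintro _ ⟨u, -, rfl⟩
    have := hcoer u
    have : 0 ≤ c / 2 * ‖u‖ ^ p := by positivity
    linarith
  set m := sInf (J '' K) with hm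
  have hmle : ∀ u ∈ K, m ≤ J u := fun u hu => csInf_le hbdd (mem_image_of_mem _ hu)
  have hdefect : ∀ u ∈ K, ∀ v ∈ K,
      c * ((‖u‖ ^ p + ‖v‖ ^ p) / 2 - ‖(2⁻¹ : ℝ) • (u + v)‖ ^ p) ≤ (J u + J v) / 2 - m := by
    intro u hu v hv
    have h1 := hmle _ (hmid u hu v hv)
    have h2 := hFmid u v
    simp only [hJ] at h1 ⊢
    linarith
  have hbound : ∀ u, J u ≤ m + 1 → ‖u‖ ^ p ≤ 2 / c * (m + 1 + A) := fun u hu => by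
    have h1 := hcoer u
    have : c / 2 * ‖u‖ ^ p ≤ m + 1 + A := by linarith
    calc ‖u‖ ^ p = 2 / c * (c / 2 * ‖u‖ ^ p) := by field_simp
      _ ≤ _ := mul_le_mul_of_nonneg_left this (by positivity)
  set R := 2 / c * (m + 1 + A) with hR
  have hclose : ∀ ρ : ℝ, 0 < ρ → ∃ η : ℝ, 0 < η ∧ η ≤ 1 ∧ ∀ u ∈ K, ∀ v ∈ K, J u ≤ m + η →
      J v ≤ m + η → ‖u - v‖ < ρ := by
    intro ρ hρ
    set r : ℝ := ρ ^ p with hr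
    have hrpos : 0 < r := by positivity
    have hRpos : 0 ≤ |R| := abs_nonneg _
    -- The error term is to cost at most `r / 2` on pairs whose `p`-th powers are bounded by `|R|`,
    -- and the choice of `η` makes the defect term cost at most `r / 4`. The cap `η ≤ 1` is what
    -- makes the bound `R` available.
    obtain ⟨C, hC0, hC⟩ := hE (r / (4 * (|R| + 1))) (by positivity)
    refine ⟨min 1 (c * r / (4 * (C + 1))), by positivity, min_le_left _ _, ?_⟩
    intro u hu v hv hJu hJv
    set η := min 1 (c * r / (4 * (C + 1)))
    have hη1 : η ≤ 1 := min_le_left _ _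
    have hη2 : η ≤ c * r / (4 * (C + 1)) := min_le_right _ _
    have hu' := (hbound u (by linarith)).trans (le_abs_self R)
    have hv' := (hbound v (by linarith)).trans (le_abs_self R)
    have hd := hdefect u hu v hv
    have h1 := hC u v
    have h2 : r / (4 * (|R| + 1)) * (‖u‖ ^ p + ‖v‖ ^ p) ≤ r / 2 := by
      calc r / (4 * (|R| + 1)) * (‖u‖ ^ p + ‖v‖ ^ p) ≤ r / (4 * (|R| + 1)) * (2 * (|R| + 1)) :=
            mul_le_mul_of_nonneg_left (by linarith) (by positivity)
        _ = r / 2 := by field_simp; norm_num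
    have h3 : C * ((‖u‖ ^ p + ‖v‖ ^ p) / 2 - ‖(2⁻¹ : ℝ) • (u + v)‖ ^ p) ≤ r / 4 := by
      have h4 : (‖u‖ ^ p + ‖v‖ ^ p) / 2 - ‖(2⁻¹ : ℝ) • (u + v)‖ ^ p ≤ r / (4 * (C + 1)) := by
        refine le_of_mul_le_mul_left ?_ hc
        rw [← mul_div_assoc]
        linarith
      calc _ ≤ C * (r / (4 * (C + 1))) := mul_le_mul_of_nonneg_left h4 hC0
        _ ≤ (C + 1) * (r / (4 * (C + 1))) :=
            mul_le_mul_of_nonneg_right (by linarith) (by positivity)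
        _ = r / 4 := by field_simp
    have h5 : ‖u - v‖ ^ p < ρ ^ p := by linarith
    exact (Real.rpow_lt_rpow_iff (norm_nonneg _) hρ.le hp0).1 h5
  have hseq : ∀ n : ℕ, ∃ u ∈ K, J u < m + 1 / ((n : ℝ) + 1) := fun n => by
    obtain ⟨_, ⟨u, hu, rfl⟩, h⟩ := exists_lt_of_csInf_lt (hne.image J)
      (show sInf (J '' K) < m + 1 / ((n : ℝ) + 1) from lt_add_of_pos_right _ (by positivity))
    exact ⟨u, hu, h⟩
  choose u huK huJ using hseq
  have hcauchy : CauchySeq u := by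
    refine Metric.cauchySeq_iff.2 fun ρ hρ => ?_
    obtain ⟨η, hη, -, h⟩ := hclose ρ hρ
    obtain ⟨N, hN⟩ := exists_nat_one_div_lt hη
    have hle : ∀ n ≥ N, J (u n) ≤ m + η := fun n hn => by
      have h1 : 1 / ((n : ℝ) + 1) ≤ 1 / ((N : ℝ) + 1) :=
        one_div_le_one_div_of_le (by positivity) (by exact_mod_cast Nat.succ_le_succ hn)
      linarith [huJ n]
    refine ⟨N, fun n hn k hk => ?_⟩
    rw [dist_eq_norm]
    exact h _ (huK n) _ (huK k) (hle n hn) (hle k hk)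
  obtain ⟨u₀, hu₀⟩ := cauchySeq_tendsto_of_complete hcauchy
  have hu₀K : u₀ ∈ K := hK.mem_of_tendsto hu₀ (Eventually.of_forall huK)
  have hJcont : Continuous J :=
    hF.add ((continuous_norm.rpow_const fun _ => Or.inr hp0.le).const_mul c)
  have hJu₀ : J u₀ ≤ m := by
    have h1 : Tendsto (fun n : ℕ => m + 1 / ((n : ℝ) + 1)) atTop (𝓝 (m + 0)) :=
      tendsto_const_nhds.add tendsto_one_div_add_atTop_nhds_zero_nat
    rw [add_zero] at h1
    exact le_of_tendsto_of_tendsto' ((hJcont.tendsto u₀).comp hu₀) h1 fun n => (huJ n).le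
  refine ⟨u₀, ⟨hu₀K, fun v hv => hJu₀.trans (hmle v hv)⟩, ?_⟩
  rintro v ⟨hvK, hv⟩
  have hJv : J v ≤ m := (hv u₀ hu₀K).trans hJu₀
  refine eq_of_forall_dist_le fun ρ hρ => ?_
  obtain ⟨η, hη, -, h⟩ := hclose ρ hρ
  rw [dist_eq_norm]
  exact (h v hvK u₀ hu₀K (by linarith) (by linarith)).le

end Minimization

/-! ### Duality of `L^p` and `L^q` -/

section Duality

variable {E X : Type*} [NormedAddCommGroup E] [InnerProductSpace ℝ E] [MeasurableSpace X]
  {μ : Measure X} {p q : ℝ}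

/-- Majorant for differentiating `∫ ‖v + t h‖ ^ p` under the integral: `s = ‖v‖ + ‖h‖` serves all
`|t| ≤ 1`. The exponent `p - 2` may be negative, so `a = 0` is treated apart. -/
theorem abs_mul_norm_rpow_sub_two_mul_inner_le {p : ℝ} (hp : 1 < p) (a b : E) {s : ℝ}
    (ha : ‖a‖ ≤ s) (hb : ‖b‖ ≤ s) :
    |p * ‖a‖ ^ (p - 2) * inner ℝ a b| ≤ p * s ^ p := by
  have hp0 : 0 < p := by linarith
  have hs : 0 ≤ s := (norm_nonneg a).trans ha
  rw [abs_mul, abs_mul, abs_of_pos hp0, abs_of_nonneg (by positivity), mul_assoc]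
  refine mul_le_mul_of_nonneg_left ?_ hp0.le
  rcases (norm_nonneg a).eq_or_lt with h | h
  · rw [norm_eq_zero.1 h.symm, inner_zero_left]
    simp only [abs_zero, mul_zero]
    positivity
  · calc ‖a‖ ^ (p - 2) * |inner ℝ a b| ≤ ‖a‖ ^ (p - 2) * (‖a‖ * ‖b‖) :=
          mul_le_mul_of_nonneg_left (abs_real_inner_le_norm a b) (by positivity)
      _ = ‖a‖ ^ (p - 1) * ‖b‖ := by
          rw [← mul_assoc, ← Real.rpow_add_one h.ne']; congr 2; ring
      _ ≤ s ^ (p - 1) * s := mul_le_mul (Real.rpow_le_rpow h.le ha (by linarith)) hb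
          (norm_nonneg _) (by positivity)
      _ = s ^ p := by
          rw [← Real.rpow_add_one (h.trans_le ha).ne']; congr 1; ring

theorem hasDerivAt_integral_norm_add_smul_rpow (hp : 1 < p) (v h : Lp E (ENNReal.ofReal p) μ) :
    HasDerivAt (fun t : ℝ => ∫ x, ‖v x + t • h x‖ ^ p ∂μ)
      (∫ x, p * ‖v x‖ ^ (p - 2) * inner ℝ (v x) (h x) ∂μ) 0 := by
  have hp0 : 0 < p := by linarith
  have hv := Lp.memLp v
  have hh := Lp.memLp h
  have hm : ∀ t : ℝ, AEStronglyMeasurable (fun x => ‖v x + t • h x‖ ^ p) μ := fun t =>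
    ((hv.1.add (hh.1.const_smul t)).norm.aemeasurable.pow_const p).aestronglyMeasurable
  have hderiv : ∀ (x : X) (t : ℝ), HasDerivAt (fun t : ℝ => ‖v x + t • h x‖ ^ p)
      (p * ‖v x + t • h x‖ ^ (p - 2) * inner ℝ (v x + t • h x) (h x)) t := fun x t => by
    have h1 : HasDerivAt (fun t : ℝ => v x + t • h x) (h x) t := by
      simpa using ((hasDerivAt_id t).smul_const (h x)).const_add (v x)
    have h2 := (hasFDerivAt_norm_rpow (v x + t • h x) hp).comp_hasDerivAt t h1
    exact h2
  have hbd : Integrable (fun x => p * (‖v x‖ + ‖h x‖) ^ p) μ := by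
    have h1 := ((hv.norm.add hh.norm).integrable_norm_rpow (by simpa using hp0)
      ENNReal.ofReal_ne_top).const_mul p
    rw [ENNReal.toReal_ofReal hp0.le] at h1
    refine h1.congr (Eventually.of_forall fun x => ?_)
    simp only [Pi.add_apply]
    rw [Real.norm_of_nonneg (by positivity)]
  have hmeas' : AEStronglyMeasurable
      (fun x => p * ‖v x + (0 : ℝ) • h x‖ ^ (p - 2) * inner ℝ (v x + (0 : ℝ) • h x) (h x)) μ := by
    have h0 : AEStronglyMeasurable (fun x => v x + (0 : ℝ) • h x) μ :=
      hv.1.add (hh.1.const_smul (0 : ℝ))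
    exact ((h0.norm.aemeasurable.pow_const (p - 2)).const_mul p).aestronglyMeasurable.mul
      (h0.inner hh.1)
  have key := (hasDerivAt_integral_of_dominated_loc_of_deriv_le (μ := μ)
    (F := fun (t : ℝ) x => ‖v x + t • h x‖ ^ p) (x₀ := (0 : ℝ)) (s := Metric.ball 0 1)
    (F' := fun t x => p * ‖v x + t • h x‖ ^ (p - 2) * inner ℝ (v x + t • h x) (h x))
    (bound := fun x => p * (‖v x‖ + ‖h x‖) ^ p)
    (Metric.ball_mem_nhds _ one_pos) (Eventually.of_forall hm)
    ?_ hmeas' (Eventually.of_forall fun x t ht => ?_) hbd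
    (Eventually.of_forall fun x t _ => hderiv x t)).2
  · simpa using key
  · simpa using Lp_integrable_norm_rpow hp0 v
  · rw [Real.norm_eq_abs]
    refine abs_mul_norm_rpow_sub_two_mul_inner_le hp _ _ ?_ (by linarith [norm_nonneg (v x)])
    refine (norm_add_le _ _).trans (add_le_add le_rfl ?_)
    rw [norm_smul]
    have : ‖t‖ ≤ 1 := by simpa using (mem_ball_zero_iff.1 ht).le
    exact mul_le_of_le_one_left (norm_nonneg _) this

/-- The field has norm `‖v‖ ^ (p - 1)`, and `q = p / (p - 1)`. -/
theorem memLp_norm_rpow_sub_two_smul (hpq : p.HolderConjugate q) {v : X → E}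
    (hv : MemLp v (ENNReal.ofReal p) μ) :
    MemLp (fun x => ‖v x‖ ^ (p - 2) • v x) (ENNReal.ofReal q) μ := by
  have hp1 : 0 < p - 1 := hpq.sub_one_pos
  have h1 := hv.norm_rpow_div (ENNReal.ofReal (p - 1))
  have h2 : ENNReal.ofReal p / ENNReal.ofReal (p - 1) = ENNReal.ofReal q := by
    rw [← ENNReal.ofReal_div_of_pos hp1, hpq.conjugate_eq]
  rw [h2, ENNReal.toReal_ofReal hp1.le] at h1
  refine h1.of_le ((hv.1.norm.aemeasurable.pow_const (p - 2)).aestronglyMeasurable.smul hv.1)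
    (Eventually.of_forall fun x => ?_)
  rw [norm_smul, Real.norm_of_nonneg (by positivity), Real.norm_of_nonneg (by positivity)]
  rcases (norm_nonneg (v x)).eq_or_lt with h | h
  · rw [← h]; simp only [mul_zero]; positivity
  · rw [← Real.rpow_add_one h.ne']
    apply le_of_eq; congr 1; ring

/-- Every continuous functional on `L^p` is represented by an element of `L^q`. -/
theorem exists_Lp_forall_eq_integral_inner [StrictConvexSpace ℝ E] [ProperSpace E]
    (hpq : p.HolderConjugate q) [Fact (1 ≤ ENNReal.ofReal p)]
    (L : StrongDual ℝ (Lp E (ENNReal.ofReal p) μ)) :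
    ∃ w : Lp E (ENNReal.ofReal q) μ, ∀ h : Lp E (ENNReal.ofReal p) μ,
      L h = ∫ x, inner ℝ (w x) (h x) ∂μ := by
  have hp : 1 < p := hpq.lt
  have hp0 : 0 < p := by linarith
  have : CompleteSpace E := inferInstance
  -- Let `v` minimize `p⁻¹ * ‖u‖ ^ p - L u`. Its derivative in every direction `h` vanishes, which
  -- says that `‖v‖ ^ (p - 2) • v` represents `L`.
  obtain ⟨v, ⟨-, hv⟩, -⟩ := existsUnique_minimizer_of_uniformlyConvexPow
    (E := Lp E (ENNReal.ofReal p) μ) hp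
    ((uniformlyConvexPow_of_strictConvexSpace hp).lp hp0) (K := univ) isClosed_univ
    univ_nonempty (by simp) (F := fun u => -L u) L.continuous.neg
    (fun u v => by simp only [map_smul, map_add, smul_eq_mul]; linarith) (B := ‖L‖)
    (fun u => neg_le_neg ((le_abs_self _).trans (L.le_opNorm u)))
    (c := p⁻¹) (by positivity)
  have hq := memLp_norm_rpow_sub_two_smul hpq (Lp.memLp v)
  refine ⟨hq.toLp _, fun h => ?_⟩
  have hd : HasDerivAt (fun t : ℝ => -(L v + t * L h) + p⁻¹ * ∫ x, ‖v x + t • h x‖ ^ p ∂μ)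
      (-(1 * L h) + p⁻¹ * ∫ x, p * ‖v x‖ ^ (p - 2) * inner ℝ (v x) (h x) ∂μ) 0 :=
    (((hasDerivAt_id (0 : ℝ)).mul_const (L h)).const_add (L v)).neg.add
      ((hasDerivAt_integral_norm_add_smul_rpow hp v h).const_mul _)
  have hnorm : ∀ t : ℝ, ‖v + t • h‖ ^ p = ∫ x, ‖v x + t • h x‖ ^ p ∂μ := fun t => by
    rw [Lp_norm_rpow_eq_integral hp0]
    refine integral_congr_ae ?_
    filter_upwards [Lp.coeFn_add v (t • h), Lp.coeFn_smul t h] with x h1 h2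
    rw [h1, Pi.add_apply, h2, Pi.smul_apply]
  have hmin : IsLocalMin
      (fun t : ℝ => -(L v + t * L h) + p⁻¹ * ∫ x, ‖v x + t • h x‖ ^ p ∂μ) 0 := by
    refine Eventually.of_forall fun t => ?_
    have h1 := hv (v + t • h) (mem_univ _)
    have h2 := hnorm 0
    rw [zero_smul, add_zero] at h2
    rw [hnorm t, h2, map_add, map_smul, smul_eq_mul] at h1
    simpa using h1
  have h0 := hmin.hasDerivAt_eq_zero hd
  have h1 : ∫ x, p * ‖v x‖ ^ (p - 2) * inner ℝ (v x) (h x) ∂μ =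
      p * ∫ x, inner ℝ (hq.toLp _ x) (h x) ∂μ := by
    rw [← integral_const_mul]
    refine integral_congr_ae ?_
    filter_upwards [hq.coeFn_toLp] with x hx
    rw [hx, real_inner_smul_left]
    ring
  rw [h1, ← mul_assoc, inv_mul_cancel₀ hp0.ne'] at h0
  linarith

/-- The pairing `∫ ⟨f, g⟩` of `L^p` and `L^q`. -/
noncomputable def innerPairing (μ : Measure X) (P Q : ℝ≥0∞) [Fact (1 ≤ P)] [Fact (1 ≤ Q)]
    [ENNReal.HolderConjugate P Q] : Lp E P μ →L[ℝ] Lp E Q μ →L[ℝ] ℝ :=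
  (isBoundedBilinearMap_inner (𝕜 := ℝ) (E := E)).toContinuousLinearMap.lpPairing μ P Q

theorem innerPairing_apply {P Q : ℝ≥0∞} [Fact (1 ≤ P)] [Fact (1 ≤ Q)]
    [ENNReal.HolderConjugate P Q] (f : Lp E P μ) (g : Lp E Q μ) :
    innerPairing μ P Q f g = ∫ x, inner ℝ (f x) (g x) ∂μ :=
  ContinuousLinearMap.lpPairing_eq_integral _ f g

end Duality

/-! ### Dilated kernels -/

section Dilation

variable {d : ℕ} {F : Type*} [NormedAddCommGroup F] [NormedSpace ℝ F]

/-- The function `ζ`, transported from the origin to `x` and scaled down by the factor `t` so that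
its integral does not change. -/
noncomputable def dilate (t : ℝ) (x : Euc d) (ζ : Euc d → F) (z : Euc d) : F :=
  (t ^ d)⁻¹ • ζ (t⁻¹ • (z - x))

theorem integral_dilate {t : ℝ} (ht : 0 < t) (x : Euc d) (ζ : Euc d → F) :
    ∫ z, dilate t x ζ z = ∫ z, ζ z := by
  simp only [dilate]
  rw [integral_smul, integral_sub_right_eq_self (fun z => ζ (t⁻¹ • z)) x,
    Measure.integral_comp_inv_smul, finrank_euclideanSpace_fin, abs_of_pos (by positivity),
    smul_smul, inv_mul_cancel₀ (by positivity), one_smul]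

theorem dilate_eq_zero {t : ℝ} (ht : 0 < t) {x v : Euc d} {r : ℝ} {ζ : Euc d → F}
    (hζ : ∀ y ∉ Metric.closedBall v r, ζ y = 0) {z : Euc d}
    (hz : z ∉ Metric.closedBall (x + t • v) (t * r)) : dilate t x ζ z = 0 := by
  rw [dilate, hζ, smul_zero]
  intro h
  apply hz
  rw [mem_closedBall_iff_norm] at h ⊢
  have : z - (x + t • v) = t • (t⁻¹ • (z - x) - v) := by
    rw [smul_sub, smul_smul, mul_inv_cancel₀ ht.ne', one_smul]; abel
  rw [this, norm_smul, Real.norm_of_nonneg ht.le]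
  exact mul_le_mul_of_nonneg_left h ht.le

theorem hasCompactSupport_dilate {t : ℝ} (ht : 0 < t) {x v : Euc d} {r : ℝ} {ζ : Euc d → F}
    (hζ : ∀ y ∉ Metric.closedBall v r, ζ y = 0) : HasCompactSupport (dilate t x ζ) :=
  HasCompactSupport.intro (isCompact_closedBall (x + t • v) (t * r))
    fun _ hz => dilate_eq_zero ht hζ hz

theorem tsupport_dilate_subset {t : ℝ} (ht : 0 < t) {x v : Euc d} {r : ℝ} {ζ : Euc d → F}
    (hζ : ∀ y ∉ Metric.closedBall v r, ζ y = 0) :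
    tsupport (dilate t x ζ) ⊆ Metric.closedBall (x + t • v) (t * r) :=
  closure_minimal (fun _ hz => by_contra fun h => hz (dilate_eq_zero ht hζ h))
    Metric.isClosed_closedBall

theorem contDiff_dilate (t : ℝ) (x : Euc d) {ζ : Euc d → F} (hζ : ContDiff ℝ ∞ ζ) :
    ContDiff ℝ ∞ (dilate t x ζ) :=
  (hζ.comp ((contDiff_id.sub contDiff_const).const_smul t⁻¹)).const_smul (t ^ d)⁻¹

theorem continuous_dilate (t : ℝ) (x : Euc d) {ζ : Euc d → F} (hζ : Continuous ζ) :
    Continuous (dilate t x ζ) :=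
  (hζ.comp ((continuous_id.sub continuous_const).const_smul t⁻¹)).const_smul (t ^ d)⁻¹

/-- This ball is the slice at height `t` of the cone with vertex `x`, and it carries the support of
the dilated kernel. -/
theorem closedBall_subset_of_cone {U : Set (Euc d)} {x v : Euc d} {r t : ℝ} (ht : 0 < t)
    (ht1 : t ≤ 1) (hcone : ∀ t ∈ Icc (0 : ℝ) 1, ∀ θ ∈ Metric.closedBall v r, x + t • θ ∈ U) :
    Metric.closedBall (x + t • v) (t * r) ⊆ U := by
  intro z hz
  have h : z = x + t • (t⁻¹ • (z - x)) := by
    rw [smul_smul, mul_inv_cancel₀ ht.ne', one_smul]; abel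
  rw [h]
  refine hcone t ⟨ht.le, ht1⟩ _ ?_
  rw [mem_closedBall_iff_norm] at hz ⊢
  have h2 : t⁻¹ • (z - x) - v = t⁻¹ • (z - (x + t • v)) := by
    rw [← sub_sub, smul_sub t⁻¹ (z - x), smul_smul, inv_mul_cancel₀ ht.ne', one_smul]
  rw [h2, norm_smul, Real.norm_of_nonneg (by positivity), inv_mul_le_iff₀ ht]
  exact hz

/-- The prefactor contributes `t ^ (-d * q)` and the change of variables `t ^ d`; since `q - 1 = q /
p`, the `q`-th root of the product is `t ^ (-d / p)`. -/
theorem integral_norm_dilate_rpow_le {p q : ℝ} (hpq : p.HolderConjugate q) {t : ℝ} (ht : 0 < t)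
    (x : Euc d) {v : Euc d} {r : ℝ} {ζ : Euc d → F} (hc : Continuous ζ)
    (hζ : ∀ y ∉ Metric.closedBall v r, ζ y = 0) (U : Set (Euc d)) :
    (∫ z in U, ‖dilate t x ζ z‖ ^ q) ^ (1 / q) ≤
      t ^ (-(d / p) : ℝ) * (∫ y, ‖ζ y‖ ^ q) ^ (1 / q) := by
  have hq : 0 < q := hpq.symm.pos
  have hcont : Continuous fun z => ‖dilate t x ζ z‖ ^ q :=
    (continuous_dilate t x hc).norm.rpow_const fun _ => Or.inr hq.le
  have hint : Integrable fun z => ‖dilate t x ζ z‖ ^ q := by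
    refine hcont.integrable_of_hasCompactSupport ?_
    refine HasCompactSupport.intro (isCompact_closedBall (x + t • v) (t * r)) fun z hz => ?_
    simp only [dilate_eq_zero ht hζ hz, norm_zero, Real.zero_rpow hq.ne']
  have h1 : ∫ z, ‖dilate t x ζ z‖ ^ q = t ^ (-(d / p * q) : ℝ) * ∫ y, ‖ζ y‖ ^ q := by
    rw [← integral_dilate ht x fun y => ‖ζ y‖ ^ q, ← integral_const_mul]
    refine integral_congr_ae (Eventually.of_forall fun z => ?_)
    simp only [dilate, norm_smul, smul_eq_mul]
    rw [Real.mul_rpow (norm_nonneg _) (norm_nonneg _), Real.norm_of_nonneg (by positivity),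
      ← mul_assoc]
    congr 1
    rw [← Real.rpow_natCast, ← Real.rpow_neg ht.le, ← Real.rpow_mul ht.le, ← Real.rpow_add ht]
    congr 1
    have : q / p = q - 1 := hpq.symm.div_conj_eq_sub_one
    rw [div_mul_eq_mul_div, mul_div_assoc, this]
    ring
  calc (∫ z in U, ‖dilate t x ζ z‖ ^ q) ^ (1 / q)
      ≤ (∫ z, ‖dilate t x ζ z‖ ^ q) ^ (1 / q) :=
        Real.rpow_le_rpow (integral_nonneg fun _ => by positivity)
          (setIntegral_le_integral hint (Eventually.of_forall fun _ => by positivity))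
          (by positivity)
    _ = _ := by
        rw [h1, Real.mul_rpow (by positivity) (integral_nonneg fun _ => by positivity),
          ← Real.rpow_mul ht.le]
        congr 2
        field_simp

/-- The function `d * η y + fderiv ℝ η y y` is the divergence of `η y • y`. So the derivative in `t`
is minus the divergence in `z` of the dilate of `η y • y`, ready for integration by parts. -/
theorem hasDerivAt_dilate {η : Euc d → ℝ} (hη : ContDiff ℝ ∞ η) (x z : Euc d) {t : ℝ}
    (ht : 0 < t) :
    HasDerivAt (fun s => dilate s x η z)
      (-(t⁻¹ * dilate t x (fun y => d * η y + fderiv ℝ η y y) z)) t := by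
  have h1 : HasDerivAt (fun s : ℝ => s⁻¹ • (z - x)) (-(t ^ 2)⁻¹ • (z - x)) t :=
    (hasDerivAt_inv ht.ne').smul_const (z - x)
  have hd : DifferentiableAt ℝ η (t⁻¹ • (z - x)) := (hη.differentiable (by simp)) _
  have h2 := hd.hasFDerivAt.comp_hasDerivAt t h1
  have h3 : HasDerivAt (fun s : ℝ => (s ^ d)⁻¹) (-(d * t ^ (d - 1)) / (t ^ d) ^ 2) t :=
    (hasDerivAt_pow d t).inv (by positivity)
  have h4 := h3.mul h2
  refine h4.congr_deriv ?_
  simp only [dilate, smul_eq_mul, Function.comp_apply, map_smul]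
  -- The case `d = 0` is separate because of the truncated exponent `d - 1`.
  rcases d with _ | d
  · simp only [Nat.cast_zero, zero_mul, neg_zero, zero_div, pow_zero, inv_one, one_mul, zero_add]
    field_simp
  · simp only [Nat.add_sub_cancel]
    field_simp
    ring

end Dilation

/-! ### Morrey's estimate at the vertex of a cone -/

section Morrey

variable {d : ℕ} {U : Set (Euc d)} {f : Euc d → ℝ} {g : Euc d → Euc d}

theorem HasWeakGradient.integral_mul_fderiv_single (hw : HasWeakGradient U f g)
    (hf : Integrable f (volume.restrict U)) (hg : Integrable g (volume.restrict U))
    {φ : Euc d → ℝ} (hφ : ContDiff ℝ ∞ φ) (hc : HasCompactSupport φ) (hU : tsupport φ ⊆ U)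
    (i : Fin d) :
    ∫ z in U, f z * fderiv ℝ φ z (EuclideanSpace.single i 1) = -∫ z in U, φ z * g z i := by
  have hgc : Continuous (gradient φ) :=
    (InnerProductSpace.toDual ℝ (Euc d)).symm.continuous.comp (hφ.continuous_fderiv (by simp))
  have hgs : HasCompactSupport (gradient φ) :=
    (hc.fderiv (𝕜 := ℝ)).comp_left (g := (InnerProductSpace.toDual ℝ (Euc d)).symm) (map_zero _)
  have i1 : Integrable (fun z => f z • gradient φ z) (volume.restrict U) :=
    hf.locallyIntegrable.integrable_smul_right_of_hasCompactSupport hgc hgs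
  have i2 : Integrable (fun z => φ z • g z) (volume.restrict U) :=
    hg.locallyIntegrable.integrable_smul_left_of_hasCompactSupport hφ.continuous hc
  have h := congrArg (EuclideanSpace.proj i : Euc d →L[ℝ] ℝ) (hw φ hφ hc hU)
  rw [map_neg, ← ContinuousLinearMap.integral_comp_comm _ i1,
    ← ContinuousLinearMap.integral_comp_comm _ i2] at h
  simpa [← inner_gradient_left, EuclideanSpace.inner_single_right] using h

/-- The kernel on the left is the divergence in `z` of the dilate of `η y • y`. Each coordinate `η y
* y i` gives a test function supported in `U`; the weak gradient identities are summed over `i`. -/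
theorem HasWeakGradient.integral_mul_dilate (hw : HasWeakGradient U f g)
    (hf : Integrable f (volume.restrict U)) (hg : Integrable g (volume.restrict U))
    {η : Euc d → ℝ} (hη : ContDiff ℝ ∞ η) {x v : Euc d} {r : ℝ}
    (hs : ∀ y ∉ Metric.closedBall v r, η y = 0) {t : ℝ} (ht : 0 < t)
    (hU : Metric.closedBall (x + t • v) (t * r) ⊆ U) :
    ∫ z in U, f z * (t⁻¹ * dilate t x (fun y => d * η y + fderiv ℝ η y y) z) =
      -∫ z in U, inner ℝ (dilate t x (fun y => η y • y) z) (g z) := by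
  set ψ : Fin d → Euc d → ℝ := fun i y => η y * y i with hψ
  have hcoord : ∀ i : Fin d, ContDiff ℝ ∞ fun y : Euc d => y i := fun i =>
    (EuclideanSpace.proj i : Euc d →L[ℝ] ℝ).contDiff
  have hψs : ∀ i, ∀ y ∉ Metric.closedBall v r, ψ i y = 0 := fun i y hy => by
    simp only [hψ, hs y hy, zero_mul]
  have hψd : ∀ i, ContDiff ℝ ∞ (ψ i) := fun i => hη.mul (hcoord i)
  have hcd : ∀ i, ContDiff ℝ ∞ (dilate t x (ψ i)) := fun i => contDiff_dilate t x (hψd i)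
  have hcs : ∀ i, HasCompactSupport (dilate t x (ψ i)) := fun i =>
    hasCompactSupport_dilate ht (hψs i)
  have key : ∀ i, ∫ z in U, f z * fderiv ℝ (dilate t x (ψ i)) z (EuclideanSpace.single i 1) =
      -∫ z in U, dilate t x (ψ i) z * g z i := fun i =>
    hw.integral_mul_fderiv_single hf hg (hcd i) (hcs i)
      ((tsupport_dilate_subset ht (hψs i)).trans hU) i
  have i1 : ∀ i, Integrable
      (fun z => f z * fderiv ℝ (dilate t x (ψ i)) z (EuclideanSpace.single i 1))
      (volume.restrict U) := fun i => by
    have hc : Continuous fun z => fderiv ℝ (dilate t x (ψ i)) z (EuclideanSpace.single i 1) :=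
      ((hcd i).continuous_fderiv (by simp)).clm_apply continuous_const
    have hc' : HasCompactSupport
        fun z => fderiv ℝ (dilate t x (ψ i)) z (EuclideanSpace.single i 1) :=
      ((hcs i).fderiv (𝕜 := ℝ)).comp_left
        (g := fun L : Euc d →L[ℝ] ℝ => L (EuclideanSpace.single i 1)) (by simp)
    exact hf.locallyIntegrable.integrable_smul_right_of_hasCompactSupport hc hc'
  have hgi : ∀ i, Integrable (fun z => g z i) (volume.restrict U) := fun i =>
    (EuclideanSpace.proj i : Euc d →L[ℝ] ℝ).integrable_comp hg
  have i2 : ∀ i, Integrable (fun z => dilate t x (ψ i) z * g z i) (volume.restrict U) := fun i =>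
    (hgi i).locallyIntegrable.integrable_smul_left_of_hasCompactSupport (hcd i).continuous (hcs i)
  have e1 : ∀ z, f z * (t⁻¹ * dilate t x (fun y => d * η y + fderiv ℝ η y y) z) =
      ∑ i, f z * fderiv ℝ (dilate t x (ψ i)) z (EuclideanSpace.single i 1) := fun z => by
    rw [← Finset.mul_sum]
    congr 1
    set y := t⁻¹ • (z - x) with hy
    have hfd : ∀ i, fderiv ℝ (dilate t x (ψ i)) z (EuclideanSpace.single i 1) =
        (t ^ d)⁻¹ * (t⁻¹ * (fderiv ℝ η y (EuclideanSpace.single i 1) * y i + η y)) := fun i => by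
      have h1 : HasFDerivAt (fun z : Euc d => t⁻¹ • (z - x))
          (t⁻¹ • ContinuousLinearMap.id ℝ (Euc d)) z :=
        ((hasFDerivAt_id z).sub_const x).const_smul t⁻¹
      have h2 : HasFDerivAt (ψ i) (η y • (EuclideanSpace.proj i : Euc d →L[ℝ] ℝ) + y i • fderiv ℝ η y) y :=
        ((hη.differentiable (by simp)) y).hasFDerivAt.mul
          (EuclideanSpace.proj i : Euc d →L[ℝ] ℝ).hasFDerivAt
      have h3 : HasFDerivAt (dilate t x (ψ i)) _ z := (h2.comp z h1).const_smul (t ^ d)⁻¹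
      rw [h3.fderiv]
      simp
      ring
    simp only [hfd, ← Finset.mul_sum, Finset.sum_add_distrib]
    have hsum : ∑ i, fderiv ℝ η y (EuclideanSpace.single i 1) * y i = fderiv ℝ η y y := by
      have hb := congrArg (fderiv ℝ η y) ((EuclideanSpace.basisFun (Fin d) ℝ).sum_repr y)
      rw [map_sum] at hb
      rw [← hb]
      refine Finset.sum_congr rfl fun i _ => ?_
      simp [mul_comm]
    rw [hsum]
    simp only [dilate, smul_eq_mul, Finset.sum_const, Finset.card_univ, Fintype.card_fin,
      nsmul_eq_mul]
    ring
  have e2 : ∀ z, inner ℝ (dilate t x (fun y => η y • y) z) (g z) =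
      ∑ i, dilate t x (ψ i) z * g z i := fun z => by
    rw [PiLp.inner_apply]
    refine Finset.sum_congr rfl fun i _ => ?_
    simp [dilate, hψ]
    ring
  simp only [e1, e2]
  rw [integral_finsetSum _ fun i _ => i1 i, integral_finsetSum _ fun i _ => i2 i,
    ← Finset.sum_neg_distrib]
  exact Finset.sum_congr rfl fun i _ => key i

theorem hasDerivAt_integral_mul_dilate (hf : Integrable f (volume.restrict U))
    {η : Euc d → ℝ} (hη : ContDiff ℝ ∞ η) {x v : Euc d} {r : ℝ}
    (hs : ∀ y ∉ Metric.closedBall v r, η y = 0) {t : ℝ} (ht : 0 < t) :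
    HasDerivAt (fun s => ∫ z in U, f z * dilate s x η z)
      (-∫ z in U, f z * (t⁻¹ * dilate t x (fun y => d * η y + fderiv ℝ η y y) z)) t := by
  set ζ : Euc d → ℝ := fun y => d * η y + fderiv ℝ η y y with hζ
  have hcη : HasCompactSupport η :=
    HasCompactSupport.intro (isCompact_closedBall v r) hs
  have hζc : Continuous ζ :=
    (continuous_const.mul hη.continuous).add
      ((hη.continuous_fderiv (by simp)).clm_apply continuous_id)
  have hζs : HasCompactSupport ζ := by
    refine HasCompactSupport.intro (K := tsupport η) hcη fun y hy => ?_
    have h1 : η y = 0 := image_eq_zero_of_notMem_tsupport hy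
    have h2 : fderiv ℝ η y = 0 :=
      image_eq_zero_of_notMem_tsupport fun h => hy (tsupport_fderiv_subset ℝ h)
    simp [hζ, h1, h2]
  obtain ⟨M, hM⟩ := hζs.exists_bound_of_continuous hζc
  have hηb : ∀ s, Integrable (fun z => f z * dilate s x η z) (volume.restrict U) := fun s => by
    obtain ⟨N, hN⟩ := hcη.exists_bound_of_continuous hη.continuous
    refine hf.mul_bdd (c := |(s ^ d)⁻¹| * N)
      (continuous_dilate s x hη.continuous).aestronglyMeasurable
      (Eventually.of_forall fun z => ?_)
    rw [dilate, norm_smul, Real.norm_eq_abs]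
    exact mul_le_mul_of_nonneg_left (hN _) (abs_nonneg _)
  have hint : ∀ s, Integrable (fun z => f z * -(s⁻¹ * dilate s x ζ z)) (volume.restrict U) :=
    fun s => by
      refine hf.mul_bdd (c := |s⁻¹| * (|(s ^ d)⁻¹| * M))
        ((continuous_const.mul (continuous_dilate s x hζc)).neg).aestronglyMeasurable
        (Eventually.of_forall fun z => ?_)
      rw [norm_neg, norm_mul, dilate, norm_smul, Real.norm_eq_abs, Real.norm_eq_abs]
      exact mul_le_mul_of_nonneg_left (mul_le_mul_of_nonneg_left (hM _) (abs_nonneg _))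
        (abs_nonneg _)
  have hM0 : 0 ≤ M := (norm_nonneg _).trans (hM 0)
  -- Restricting to `s > t / 2` keeps `s⁻¹` and `(s ^ d)⁻¹` bounded.
  have key := (hasDerivAt_integral_of_dominated_loc_of_deriv_le (μ := volume.restrict U)
    (F := fun (s : ℝ) z => f z * dilate s x η z) (x₀ := t) (s := Ioi (t / 2))
    (F' := fun s z => f z * -(s⁻¹ * dilate s x ζ z))
    (bound := fun z => ‖f z‖ * ((t / 2)⁻¹ * (((t / 2) ^ d)⁻¹ * M)))
    (Ioi_mem_nhds (by linarith)) (Eventually.of_forall fun s => (hηb s).1)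
    (hηb t) (hint t).1 (Eventually.of_forall fun z s hst => ?_) (hf.norm.mul_const _)
    (Eventually.of_forall fun z s hst =>
      (hasDerivAt_dilate hη x z ((half_pos ht).trans hst)).const_mul (f z))).2
  · refine key.congr_deriv ?_
    rw [← integral_neg]
    simp only [mul_neg]
  · have h0 : 0 < t / 2 := half_pos ht
    have hst' : t / 2 ≤ s := (mem_Ioi.1 hst).le
    have hs0 : 0 < s := h0.trans hst
    have h1 : ‖s⁻¹‖ ≤ (t / 2)⁻¹ := by
      rw [Real.norm_of_nonneg (by positivity)]
      exact inv_anti₀ h0 hst'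
    have h2 : ‖(s ^ d)⁻¹‖ ≤ ((t / 2) ^ d)⁻¹ := by
      rw [Real.norm_of_nonneg (by positivity)]
      exact inv_anti₀ (by positivity) (pow_le_pow_left₀ h0.le hst' d)
    rw [norm_mul, norm_neg, norm_mul, dilate, norm_smul]
    have h3 := mul_le_mul h2 (hM (s⁻¹ • (z - x))) (norm_nonneg _) (by positivity)
    exact mul_le_mul_of_nonneg_left (mul_le_mul h1 h3 (by positivity) (by positivity))
      (norm_nonneg _)

/-- An approximate identity: the kernels are nonnegative, of mass one, supported in the cone inside
`U`, and shrink to `x`. -/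
theorem tendsto_integral_mul_dilate (hf : Integrable f (volume.restrict U)) {x v : Euc d} {r : ℝ}
    (hfx : ContinuousAt f x) {η : Euc d → ℝ} (hη : Continuous η) (h0 : ∀ y, 0 ≤ η y)
    (h1 : ∫ y, η y = 1) (hs : ∀ y ∉ Metric.closedBall v r, η y = 0)
    (hcone : ∀ t ∈ Icc (0 : ℝ) 1, ∀ θ ∈ Metric.closedBall v r, x + t • θ ∈ U) :
    Tendsto (fun t => ∫ z in U, f z * dilate t x η z) (𝓝[>] 0) (𝓝 (f x)) := by
  refine Metric.tendsto_nhds.2 fun ε hε => ?_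
  obtain ⟨δ, hδ, hδf⟩ := Metric.continuousAt_iff.1 hfx (ε / 2) (half_pos hε)
  have hev : ∀ᶠ t : ℝ in 𝓝[>] 0, t * (‖v‖ + r) < δ := by
    have : Tendsto (fun t : ℝ => t * (‖v‖ + r)) (𝓝[>] 0) (𝓝 (0 * (‖v‖ + r))) :=
      (tendsto_id.mul_const _).mono_left nhdsWithin_le_nhds
    rw [zero_mul] at this
    exact this.eventually (gt_mem_nhds hδ)
  filter_upwards [hev, Ioo_mem_nhdsGT one_pos] with t ht1 ht2
  have ht : 0 < t := ht2.1
  have hball := closedBall_subset_of_cone ht ht2.2.le hcone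
  have hc := continuous_dilate t x hη
  have hcs := hasCompactSupport_dilate (x := x) ht hs
  have hk0 : ∀ z, 0 ≤ dilate t x η z := fun z => mul_nonneg (by positivity) (h0 _)
  have hk1 : ∫ z in U, dilate t x η z = 1 := by
    rw [setIntegral_eq_integral_of_forall_compl_eq_zero fun z hz =>
      dilate_eq_zero ht hs fun h => hz (hball h), integral_dilate ht, h1]
  have hki : Integrable (dilate t x η) (volume.restrict U) :=
    (hc.integrable_of_hasCompactSupport hcs).integrableOn
  have hfk : Integrable (fun z => f z * dilate t x η z) (volume.restrict U) :=
    hf.locallyIntegrable.integrable_smul_right_of_hasCompactSupport hc hcs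
  have e1 : (∫ z in U, f z * dilate t x η z) - f x =
      ∫ z in U, (f z - f x) * dilate t x η z := by
    simp only [sub_mul]
    rw [integral_sub hfk (hki.const_mul _), integral_const_mul, hk1, mul_one]
  rw [dist_eq_norm, e1]
  refine (norm_integral_le_of_norm_le (hki.const_mul (ε / 2)) (Eventually.of_forall fun z => ?_)
    ).trans_lt ?_
  · by_cases hz : z ∈ Metric.closedBall (x + t • v) (t * r)
    · rw [norm_mul, Real.norm_of_nonneg (hk0 z)]
      refine mul_le_mul_of_nonneg_right ?_ (hk0 z)
      rw [← dist_eq_norm]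
      refine (hδf ?_).le
      rw [mem_closedBall_iff_norm] at hz
      rw [dist_eq_norm]
      calc ‖z - x‖ = ‖(z - (x + t • v)) + t • v‖ := by congr 1; abel
        _ ≤ t * r + t * ‖v‖ := by
          refine (norm_add_le _ _).trans (add_le_add hz ?_)
          rw [norm_smul, Real.norm_of_nonneg ht.le]
        _ < δ := by linarith
    · rw [dilate_eq_zero ht hs hz]; simp
  · rw [integral_const_mul, hk1]
    linarith

/-- Since `γ < 1`, the bound on the derivative has the primitive `G t = c / (1 - γ) * t ^ (1 - γ)`,
which stays bounded down to zero. The sums `G + Φ` and `G - Φ` are monotone on `[s, 1]`, so no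
integrability of `Φ'` is needed. -/
theorem abs_le_add_of_abs_deriv_le_rpow {Φ Φ' : ℝ → ℝ} {c γ : ℝ} (hγ : γ < 1) (hc : 0 ≤ c)
    (hΦ : ∀ t, 0 < t → HasDerivAt Φ (Φ' t) t)
    (hb : ∀ t, 0 < t → t ≤ 1 → |Φ' t| ≤ c * t ^ (-γ)) {s : ℝ} (hs : 0 < s) (hs1 : s ≤ 1) :
    |Φ s| ≤ |Φ 1| + c / (1 - γ) := by
  have hγ' : 0 < 1 - γ := by linarith
  set G : ℝ → ℝ := fun t => c / (1 - γ) * t ^ (1 - γ) with hG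
  have hGd : ∀ t, 0 < t → HasDerivAt G (c * t ^ (-γ)) t := fun t ht => by
    refine ((Real.hasDerivAt_rpow_const (p := 1 - γ) (Or.inl ht.ne')).const_mul
      (c / (1 - γ))).congr_deriv ?_
    rw [show 1 - γ - 1 = -γ by ring]
    field_simp
  have mono : ∀ Ψ Ψ' : ℝ → ℝ, (∀ t, 0 < t → HasDerivAt Ψ (Ψ' t) t) →
      (∀ t, 0 < t → t ≤ 1 → |Ψ' t| ≤ c * t ^ (-γ)) → Ψ s ≤ Ψ 1 + c / (1 - γ) := by
    intro Ψ Ψ' hΨ hb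
    have hd : ∀ t, 0 < t → HasDerivAt (fun t => G t + Ψ t) (c * t ^ (-γ) + Ψ' t) t :=
      fun t ht => (hGd t ht).add (hΨ t ht)
    have hm : MonotoneOn (fun t => G t + Ψ t) (Icc s 1) := by
      refine monotoneOn_of_deriv_nonneg (convex_Icc s 1)
        (fun t ht => (hd t (hs.trans_le ht.1)).continuousAt.continuousWithinAt)
        (fun t ht => ?_) fun t ht => ?_
      all_goals
        rw [interior_Icc] at ht
        have ht0 : 0 < t := hs.trans ht.1
      · exact (hd t ht0).differentiableAt.differentiableWithinAt
      · rw [(hd t ht0).deriv]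
        linarith [neg_abs_le (Ψ' t), hb t ht0 ht.2.le]
    have h1 := hm (left_mem_Icc.2 hs1) (right_mem_Icc.2 hs1) hs1
    have h2 : 0 ≤ G s := by simp only [hG]; positivity
    have h3 : G 1 = c / (1 - γ) := by simp [hG]
    simp only at h1
    linarith
  have h1 := mono Φ Φ' hΦ hb
  have h2 := mono (fun t => -Φ t) (fun t => -Φ' t) (fun t ht => (hΦ t ht).neg)
    (fun t ht ht1 => by rw [abs_neg]; exact hb t ht ht1)
  rw [abs_le]
  constructor
  · linarith [neg_le_abs (Φ 1)]
  · linarith [le_abs_self (Φ 1)]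

/-- Morrey's estimate at a point that is the vertex of a cone contained in the domain. -/
theorem exists_forall_abs_le_of_cone {p q : ℝ} (hpq : p.HolderConjugate q) (hdp : (d : ℝ) < p)
    (v : Euc d) {r : ℝ} (hr : 0 < r) :
    ∃ C : ℝ, 0 ≤ C ∧ ∀ (U : Set (Euc d)) (f : Euc d → ℝ) (g : Euc d → Euc d),
      HasWeakGradient U f g → Integrable f (volume.restrict U) →
      Integrable g (volume.restrict U) → MemLp f (ENNReal.ofReal p) (volume.restrict U) →
      MemLp g (ENNReal.ofReal p) (volume.restrict U) → ∀ x, ContinuousAt f x →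
      (∀ t ∈ Icc (0 : ℝ) 1, ∀ θ ∈ Metric.closedBall v r, x + t • θ ∈ U) →
      |f x| ≤ C * ((∫ z in U, ‖f z‖ ^ p) ^ (1 / p) + (∫ z in U, ‖g z‖ ^ p) ^ (1 / p)) := by
  have hp0 : 0 < p := hpq.pos
  have hγ : (d : ℝ) / p < 1 := (div_lt_one hp0).2 hdp
  have hγ' : 0 < 1 - (d : ℝ) / p := by linarith
  let b : ContDiffBump v := ⟨r / 2, r, half_pos hr, half_lt_self hr⟩
  set η : Euc d → ℝ := b.normed volume with hη
  have hηd : ContDiff ℝ ∞ η := b.contDiff_normed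
  have hηs : ∀ y ∉ Metric.closedBall v r, η y = 0 := fun y hy => by
    have : tsupport η = Metric.closedBall v r := b.tsupport_normed_eq
    exact image_eq_zero_of_notMem_tsupport (this ▸ hy)
  set V : Euc d → Euc d := fun y => η y • y with hV
  have hVc : Continuous V := hηd.continuous.smul continuous_id
  have hVs : ∀ y ∉ Metric.closedBall v r, V y = 0 := fun y hy => by
    simp only [hV, hηs y hy, zero_smul]
  set A := (∫ y, ‖η y‖ ^ q) ^ (1 / q) with hA
  set B := (∫ y, ‖V y‖ ^ q) ^ (1 / q) with hB
  have hA0 : 0 ≤ A := Real.rpow_nonneg (integral_nonneg fun _ => by positivity) _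
  have hB0 : 0 ≤ B := Real.rpow_nonneg (integral_nonneg fun _ => by positivity) _
  have hBγ : 0 ≤ B / (1 - (d : ℝ) / p) := by positivity
  refine ⟨A + B / (1 - (d : ℝ) / p), by positivity, ?_⟩
  intro U f g hw hf hg hfp hgp x hfx hcone
  set Nf := (∫ z in U, ‖f z‖ ^ p) ^ (1 / p) with hNf
  set Ng := (∫ z in U, ‖g z‖ ^ p) ^ (1 / p) with hNg
  have hNf0 : 0 ≤ Nf := Real.rpow_nonneg (integral_nonneg fun _ => by positivity) _
  have hNg0 : 0 ≤ Ng := Real.rpow_nonneg (integral_nonneg fun _ => by positivity) _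
  -- `Φ t` averages `f` over the slice of the cone at height `t`. It tends to `f x` at zero, Hölder
  -- bounds it at `t = 1`, and its derivative is at most `Ng * B * t ^ (-d / p)`, integrable near
  -- zero because `d < p`.
  set Φ : ℝ → ℝ := fun t => ∫ z in U, f z * dilate t x η z with hΦ
  set ζ : Euc d → ℝ := fun y => d * η y + fderiv ℝ η y y with hζ
  have hΦd : ∀ t, 0 < t → HasDerivAt Φ (-∫ z in U, f z * (t⁻¹ * dilate t x ζ z)) t :=
    fun t ht => hasDerivAt_integral_mul_dilate hf hηd hηs ht
  have hbound : ∀ t, 0 < t → t ≤ 1 →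
      |-∫ z in U, f z * (t⁻¹ * dilate t x ζ z)| ≤ Ng * B * t ^ (-(d / p) : ℝ) := by
    intro t ht ht1
    rw [hw.integral_mul_dilate hf hg hηd hηs ht (closedBall_subset_of_cone ht ht1 hcone), neg_neg]
    have hVt : MemLp (dilate t x V) (ENNReal.ofReal q) (volume.restrict U) :=
      ((continuous_dilate t x hVc).memLp_of_hasCompactSupport
        (hasCompactSupport_dilate ht hVs)).restrict U
    calc |∫ z in U, inner ℝ (dilate t x V z) (g z)|
        ≤ ∫ z in U, |inner ℝ (dilate t x V z) (g z)| := abs_integral_le_integral_abs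
      _ ≤ ∫ z in U, ‖g z‖ * ‖dilate t x V z‖ := by
          refine integral_mono_of_nonneg (Eventually.of_forall fun _ => abs_nonneg _) ?_
            (Eventually.of_forall fun z => ?_)
          · have : ENNReal.HolderConjugate (ENNReal.ofReal p) (ENNReal.ofReal q) :=
              hpq.ennrealOfReal
            exact hgp.norm.integrable_mul hVt.norm
          · exact (abs_real_inner_le_norm _ _).trans_eq (mul_comm _ _)
      _ ≤ Ng * (∫ z in U, ‖dilate t x V z‖ ^ q) ^ (1 / q) :=
          integral_mul_norm_le_Lp_mul_Lq hpq hgp hVt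
      _ ≤ Ng * (t ^ (-(d / p) : ℝ) * B) :=
          mul_le_mul_of_nonneg_left (integral_norm_dilate_rpow_le hpq ht x hVc hVs U) hNg0
      _ = _ := by ring
  have hΦ1 : |Φ 1| ≤ A * Nf := by
    have hk : MemLp (dilate 1 x η) (ENNReal.ofReal q) (volume.restrict U) :=
      ((continuous_dilate 1 x hηd.continuous).memLp_of_hasCompactSupport
        (hasCompactSupport_dilate one_pos hηs)).restrict U
    calc |Φ 1| ≤ ∫ z in U, |f z * dilate 1 x η z| := abs_integral_le_integral_abs
      _ = ∫ z in U, ‖f z‖ * ‖dilate 1 x η z‖ := by simp only [abs_mul, Real.norm_eq_abs]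
      _ ≤ Nf * (∫ z in U, ‖dilate 1 x η z‖ ^ q) ^ (1 / q) :=
          integral_mul_norm_le_Lp_mul_Lq hpq hfp hk
      _ ≤ Nf * ((1 : ℝ) ^ (-(d / p) : ℝ) * A) :=
          mul_le_mul_of_nonneg_left
            (integral_norm_dilate_rpow_le hpq one_pos x hηd.continuous hηs U) hNf0
      _ = _ := by rw [Real.one_rpow]; ring
  have hlim := (tendsto_integral_mul_dilate hf hfx hηd.continuous (fun y => b.nonneg_normed y)
    b.integral_normed hηs hcone).abs
  have hfin : |f x| ≤ |Φ 1| + Ng * B / (1 - (d : ℝ) / p) := by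
    refine le_of_tendsto hlim ?_
    filter_upwards [Ioo_mem_nhdsGT one_pos] with s hs
    exact abs_le_add_of_abs_deriv_le_rpow hγ (by positivity) hΦd hbound hs.1 hs.2.le
  calc |f x| ≤ A * Nf + Ng * B / (1 - (d : ℝ) / p) := by linarith
    _ = A * Nf + B / (1 - (d : ℝ) / p) * Ng := by ring
    _ ≤ (A + B / (1 - (d : ℝ) / p)) * (Nf + Ng) := by
        have := mul_nonneg hA0 hNg0
        have := mul_nonneg hBγ hNf0
        linarith

end Morrey

/-! ### Cones in Lipschitz domains and the uniform sup bound -/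

section Cone

variable {d : ℕ} {U : Set (Euc d)}

/-- Near every point of its closure, a Lipschitz domain contains cones of a fixed shape. -/
theorem IsLipschitzDomain.exists_cone (hU : IsLipschitzDomain U) {x₀ : Euc d}
    (hx₀ : x₀ ∈ closure U) :
    ∃ N ∈ 𝓝 x₀, ∃ (v : Euc d) (r : ℝ), 0 < r ∧ ∀ x ∈ N ∩ U, ∀ t ∈ Icc (0 : ℝ) 1,
      ∀ θ ∈ Metric.closedBall v r, x + t • θ ∈ U := by
  by_cases hxU : x₀ ∈ U
  · obtain ⟨δ, hδ, hball⟩ := Metric.isOpen_iff.1 hU.isOpen x₀ hxU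
    -- At an interior point the cone degenerates to a ball, with axis `v = 0`.
    refine ⟨Metric.ball x₀ (δ / 2), Metric.ball_mem_nhds _ (half_pos hδ), 0, δ / 2, half_pos hδ,
      fun x hx t ht θ hθ => hball ?_⟩
    rw [mem_closedBall_zero_iff] at hθ
    have h1 := mem_ball_iff_norm.1 hx.1
    rw [mem_ball_iff_norm]
    calc ‖x + t • θ - x₀‖ = ‖(x - x₀) + t • θ‖ := by congr 1; abel
      _ ≤ ‖x - x₀‖ + ‖t • θ‖ := norm_add_le _ _
      _ < δ / 2 + δ / 2 := by
        refine add_lt_add_of_lt_of_le h1 ?_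
        rw [norm_smul, Real.norm_of_nonneg ht.1]
        exact (mul_le_of_le_one_left (norm_nonneg _) ht.2).trans hθ
      _ = δ := add_halves δ
  have hfr : x₀ ∈ frontier U := ⟨hx₀, by rwa [hU.isOpen.interior_eq]⟩
  obtain ⟨T, i, a, ψ, K, ha, hTx, hψ, -, hgraph⟩ := hU.boundary x₀ hfr
  obtain ⟨m, hm, hmj⟩ : ∃ m : ℝ, 0 < m ∧ ∀ j, |T x₀ j| + m < a j := by
    have : ∀ᶠ m : ℝ in 𝓝[>] 0, ∀ j, |T x₀ j| + m < a j := by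
      refine eventually_all.2 fun j => nhdsWithin_le_nhds ?_
      have h : Tendsto (fun m : ℝ => |T x₀ j| + m) (𝓝 0) (𝓝 (|T x₀ j| + 0)) :=
        tendsto_const_nhds.add tendsto_id
      exact h.eventually (gt_mem_nhds (by simpa using hTx j))
    obtain ⟨m, h1, h2⟩ := (this.and self_mem_nhdsWithin).exists
    exact ⟨m, h2, h1⟩
  -- The axis points down the graph with length `(K + 1) * r`. A direction within `r` of it,
  -- followed for time `t`, lowers the last coordinate by at least `t * K * r`, while `ψ` drops by
  -- at most `K * (t * r)`; the strict subgraph is preserved. Such a direction has length at most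
  -- `(K + 2) * r = m / 2`, which keeps the path in the box.
  set r : ℝ := m / (2 * (K + 2)) with hr
  have hK : (0 : ℝ) ≤ K := K.2
  have hr0 : 0 < r := by positivity
  have hrm : (K + 2) * r = m / 2 := by rw [hr]; field_simp
  set e : Euc d := EuclideanSpace.single i (1 : ℝ) with he
  set w : Euc d := -((K + 1) * r) • e with hw
  have hen : ‖e‖ = 1 := by simp [he]
  have hwn : ‖w‖ = (K + 1) * r := by
    rw [hw, norm_smul, hen, norm_neg, mul_one, Real.norm_of_nonneg (by positivity)]
  refine ⟨Metric.ball x₀ (m / 2), Metric.ball_mem_nhds _ (half_pos hm),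
    T.linearIsometryEquiv.symm w, r, hr0, ?_⟩
  rintro x ⟨hxN, hxU⟩ t ht θ hθ
  set ξ : Euc d := T.linearIsometryEquiv θ with hξ
  have hξw : ‖ξ - w‖ ≤ r := by
    have h1 := mem_closedBall_iff_norm.1 hθ
    have h2 : ξ - w = T.linearIsometryEquiv (θ - T.linearIsometryEquiv.symm w) := by
      rw [map_sub, LinearIsometryEquiv.apply_symm_apply]
    rwa [h2, LinearIsometryEquiv.norm_map]
  have hTadd : T (x + t • θ) = T x + t • ξ := by
    have h1 := T.map_vadd x (t • θ)
    rw [vadd_eq_add, vadd_eq_add, map_smul] at h1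
    rw [add_comm x, h1, add_comm]
  have hcoord : ∀ (z : Euc d) (j : Fin d), |z j| ≤ ‖z‖ := fun z j => by
    simpa using PiLp.norm_apply_le z j
  have hTxx : ‖T x - T x₀‖ < m / 2 := by
    rw [← dist_eq_norm, T.dist_map, dist_eq_norm]
    exact mem_ball_iff_norm.1 hxN
  have hξn : ‖t • ξ‖ ≤ m / 2 := by
    rw [norm_smul, Real.norm_of_nonneg ht.1]
    refine (mul_le_of_le_one_left (norm_nonneg _) ht.2).trans ?_
    calc ‖ξ‖ = ‖(ξ - w) + w‖ := by rw [sub_add_cancel]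
      _ ≤ r + (K + 1) * r := (norm_add_le _ _).trans (add_le_add hξw hwn.le)
      _ = m / 2 := by rw [← hrm]; ring
  have hbox1 : ∀ j, |T x j| < a j := fun j => by
    have h1 := (hcoord (T x - T x₀) j).trans_lt hTxx
    have h2 : T x j = T x₀ j + (T x - T x₀) j := by simp
    rw [h2]
    have := abs_add_le (T x₀ j) ((T x - T x₀) j)
    linarith [hmj j]
  have hbox2 : ∀ j, |T (x + t • θ) j| < a j := fun j => by
    have h1 := (hcoord (T x - T x₀) j).trans_lt hTxx
    have h3 := (hcoord (t • ξ) j).trans hξn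
    have h2 : T (x + t • θ) j = T x₀ j + ((T x - T x₀) j + (t • ξ) j) := by
      rw [hTadd]; simp; ring
    rw [h2]
    have := abs_add_le (T x₀ j) ((T x - T x₀) j + (t • ξ) j)
    have := abs_add_le ((T x - T x₀) j) ((t • ξ) j)
    linarith [hmj j]
  rw [((hgraph _ hbox2).1)]
  have hx1 := ((hgraph x hbox1).1).1 hxU
  set z₁ : EuclideanSpace ℝ {j : Fin d // j ≠ i} := WithLp.toLp 2 fun j => T x j with hz₁
  set z₂ : EuclideanSpace ℝ {j : Fin d // j ≠ i} := WithLp.toLp 2 fun j => T (x + t • θ) j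
    with hz₂
  have hdist : dist z₁ z₂ ≤ t * r := by
    have h1 : ∀ j : {j : Fin d // j ≠ i}, (z₁ - z₂) j = -(t * (ξ - w) j) := fun j => by
      have : e j = 0 := by simp [he, j.2]
      simp [hz₁, hz₂, hTadd, hw, this]
    have h2 : ‖z₁ - z₂‖ ≤ t * ‖ξ - w‖ := by
      rw [← abs_of_nonneg ht.1, ← Real.norm_eq_abs, ← norm_smul, EuclideanSpace.norm_eq,
        EuclideanSpace.norm_eq]
      refine Real.sqrt_le_sqrt ?_
      calc ∑ j, ‖(z₁ - z₂) j‖ ^ 2 = ∑ j : {j : Fin d // j ≠ i}, ‖(t • (ξ - w)) j‖ ^ 2 := by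
            refine Finset.sum_congr rfl fun j _ => ?_
            rw [h1, norm_neg]; rfl
        _ = ∑ j ∈ Finset.univ.filter fun j => j ≠ i, ‖(t • (ξ - w)) j‖ ^ 2 := by
            rw [← Finset.sum_subtype_eq_sum_filter, Finset.subtype_univ]
        _ ≤ _ := Finset.sum_le_sum_of_subset_of_nonneg (Finset.filter_subset _ _)
            fun _ _ _ => by positivity
    rw [dist_eq_norm]
    exact h2.trans (mul_le_mul_of_nonneg_left hξw ht.1)
  have hlip : ψ z₁ ≤ ψ z₂ + K * (t * r) := by
    have h1 := hψ.dist_le_mul z₁ (fun j => hbox1 j) z₂ (fun j => hbox2 j)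
    rw [Real.dist_eq] at h1
    have h2 := mul_le_mul_of_nonneg_left hdist hK
    linarith [le_abs_self (ψ z₁ - ψ z₂)]
  have hei : e i = 1 := by simp [he]
  have hlast : T (x + t • θ) i = T x i + t * ((ξ - w) i - (K + 1) * r) := by
    rw [hTadd]
    simp [hw, hei]
  have h3 : (ξ - w) i ≤ r := (le_abs_self _).trans ((hcoord _ _).trans hξw)
  have h4 : t * ((ξ - w) i - (K + 1) * r) ≤ t * (r - (K + 1) * r) :=
    mul_le_mul_of_nonneg_left (by linarith) ht.1
  rw [hlast]
  linarith

/-- The Sobolev embedding of `W^{1,p}` into the continuous functions on a bounded Lipschitz domain,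
for functions known to be continuous. -/
theorem IsLipschitzDomain.exists_forall_abs_le (hU : IsLipschitzDomain U)
    (hUc : IsCompact (closure U)) {p q : ℝ} (hpq : p.HolderConjugate q) (hdp : (d : ℝ) < p) :
    ∃ C : ℝ, 0 ≤ C ∧ ∀ (f : Euc d → ℝ) (g : Euc d → Euc d),
      HasWeakGradient U f g → MemLp f (ENNReal.ofReal p) (volume.restrict U) →
      MemLp g (ENNReal.ofReal p) (volume.restrict U) → ContinuousOn f (closure U) →
      ∀ x ∈ closure U,
      |f x| ≤ C * ((∫ z in U, ‖f z‖ ^ p) ^ (1 / p) + (∫ z in U, ‖g z‖ ^ p) ^ (1 / p)) := by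
  have hfin : IsFiniteMeasure (volume.restrict U) :=
    ⟨by simpa using (measure_mono subset_closure).trans_lt hUc.measure_lt_top⟩
  have h1p : 1 ≤ ENNReal.ofReal p := by simpa using hpq.lt.le
  -- Continuity carries the bound from `U` to its closure. On `U` the constant depends only on the
  -- shape of the cone, and finitely many shapes suffice by compactness. The redundant `closure U ∩
  -- U` has the form `S ∩ U` required by the induction over compact sets.
  suffices h : ∃ C : ℝ, 0 ≤ C ∧ ∀ (f : Euc d → ℝ) (g : Euc d → Euc d),
      HasWeakGradient U f g → MemLp f (ENNReal.ofReal p) (volume.restrict U) →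
      MemLp g (ENNReal.ofReal p) (volume.restrict U) → ContinuousOn f (closure U) →
      ∀ x ∈ closure U ∩ U,
      |f x| ≤ C * ((∫ z in U, ‖f z‖ ^ p) ^ (1 / p) + (∫ z in U, ‖g z‖ ^ p) ^ (1 / p)) by
    obtain ⟨C, hC, h⟩ := h
    refine ⟨C, hC, fun f g hw hf hg hc x hx => ?_⟩
    exact ContinuousWithinAt.closure_le hx ((hc x hx).mono subset_closure).abs
      continuousWithinAt_const fun y hy => h f g hw hf hg hc y ⟨subset_closure hy, hy⟩
  refine hUc.induction_on (p := fun S => ∃ C : ℝ, 0 ≤ C ∧ ∀ (f : Euc d → ℝ) (g : Euc d → Euc d),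
      HasWeakGradient U f g → MemLp f (ENNReal.ofReal p) (volume.restrict U) →
      MemLp g (ENNReal.ofReal p) (volume.restrict U) → ContinuousOn f (closure U) →
      ∀ x ∈ S ∩ U,
      |f x| ≤ C * ((∫ z in U, ‖f z‖ ^ p) ^ (1 / p) + (∫ z in U, ‖g z‖ ^ p) ^ (1 / p)))
    ⟨0, le_rfl, by simp⟩ ?_ ?_ ?_
  · rintro S S' hSS' ⟨C, hC, h⟩
    exact ⟨C, hC, fun f g hw hf hg hc x hx => h f g hw hf hg hc x ⟨hSS' hx.1, hx.2⟩⟩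
  · rintro S S' ⟨C, hC, h⟩ ⟨C', hC', h'⟩
    refine ⟨max C C', hC.trans (le_max_left _ _), fun f g hw hf hg hc x hx => ?_⟩
    have h0 : 0 ≤ (∫ z in U, ‖f z‖ ^ p) ^ (1 / p) + (∫ z in U, ‖g z‖ ^ p) ^ (1 / p) :=
      add_nonneg (Real.rpow_nonneg (integral_nonneg fun _ => by positivity) _)
        (Real.rpow_nonneg (integral_nonneg fun _ => by positivity) _)
    rcases hx.1 with hxS | hxS
    · exact (h f g hw hf hg hc x ⟨hxS, hx.2⟩).trans
        (mul_le_mul_of_nonneg_right (le_max_left _ _) h0)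
    · exact (h' f g hw hf hg hc x ⟨hxS, hx.2⟩).trans
        (mul_le_mul_of_nonneg_right (le_max_right _ _) h0)
  · intro x₀ hx₀
    obtain ⟨N, hN, v, r, hr, hcone⟩ := hU.exists_cone hx₀
    obtain ⟨C, hC, h⟩ := exists_forall_abs_le_of_cone hpq hdp v hr
    refine ⟨N, nhdsWithin_le_nhds hN, C, hC, fun f g hw hf hg hc x hx => ?_⟩
    exact h U f g hw (hf.integrable h1p) (hg.integrable h1p) hf hg x
      ((hc.mono subset_closure).continuousAt (hU.isOpen.mem_nhds hx.2)) (hcone x hx)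

end Cone

/-- Abstract passage from unique solvability to a Poincaré inequality. On the complete space `ker m`
the map `S ∘ γ` is injective with closed range `D`, hence bounded below by the bounded inverse
theorem; the factor `S` only contributes its norm. -/
theorem ContinuousLinearMap.exists_norm_le_mul_norm_of_injOn_ker {V G W : Type*}
    [NormedAddCommGroup V] [NormedSpace ℝ V] [NormedAddCommGroup G] [NormedSpace ℝ G]
    [NormedAddCommGroup W] [NormedSpace ℝ W] [CompleteSpace V] (m : V →L[ℝ] ℝ)
    (γ : V →L[ℝ] G) (S : G →L[ℝ] StrongDual ℝ W) {D : Set (StrongDual ℝ W)} (hD : IsClosed D)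
    (hinj : ∀ y y', m y = 0 → m y' = 0 → S (γ y) = S (γ y') → y = y') (hSD : ∀ g, S g ∈ D)
    (hsurj : ∀ ν ∈ D, ∃ y, m y = 0 ∧ S (γ y) = ν) :
    ∃ C : ℝ, 0 ≤ C ∧ ∀ y, m y = 0 → ‖y‖ ≤ C * ‖γ y‖ := by
  set M : Submodule ℝ V := LinearMap.ker m.toLinearMap with hM
  have : CompleteSpace M := m.isClosed_ker.completeSpace_coe
  have hrange : range (S.comp (γ.comp M.subtypeL)) = D := by
    refine Subset.antisymm (by rintro _ ⟨y, rfl⟩; exact hSD _) fun ν hν => ?_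
    obtain ⟨y, hy, h⟩ := hsurj ν hν
    exact ⟨⟨y, hy⟩, h⟩
  obtain ⟨K, hK⟩ := (S.comp (γ.comp M.subtypeL)).antilipschitz_of_injective_of_isClosed_range
    (fun y y' h => Subtype.ext (hinj y.1 y'.1 y.2 y'.2 h)) (hrange ▸ hD)
  refine ⟨K * ‖S‖, by positivity, fun y hy => ?_⟩
  have h1 := hK.le_mul_dist (⟨y, hy⟩ : M) 0
  rw [map_zero, dist_zero_right, dist_zero_right] at h1
  calc ‖y‖ ≤ K * ‖S (γ y)‖ := h1
    _ ≤ K * (‖S‖ * ‖γ y‖) := mul_le_mul_of_nonneg_left (S.le_opNorm _) K.2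
    _ = _ := by ring

/-! ### Sobolev spaces and the Poincaré inequality -/

section SobolevSpace

variable {d : ℕ} {U : Set (Euc d)}

theorem continuous_gradient_of_contDiff {φ : Euc d → ℝ} (hφ : ContDiff ℝ ∞ φ) :
    Continuous (gradient φ) :=
  (InnerProductSpace.toDual ℝ (Euc d)).symm.continuous.comp (hφ.continuous_fderiv (by simp))

theorem HasCompactSupport.gradient {φ : Euc d → ℝ} (hc : HasCompactSupport φ) :
    HasCompactSupport (gradient φ) :=
  (hc.fderiv (𝕜 := ℝ)).comp_left (g := (InnerProductSpace.toDual ℝ (Euc d)).symm) (map_zero _)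

theorem integral_gradient_eq_zero {φ : Euc d → ℝ} (hφ : ContDiff ℝ ∞ φ)
    (hc : HasCompactSupport φ) : ∫ x, gradient φ x = 0 := by
  have hi : Integrable (gradient φ) :=
    (continuous_gradient_of_contDiff hφ).integrable_of_hasCompactSupport hc.gradient
  refine ext_inner_left ℝ fun v => ?_
  rw [← integral_inner hi, inner_zero_right]
  have h1 : ∀ x, inner ℝ v (gradient φ x) = fderiv ℝ φ x v := fun x => by
    rw [inner_gradient_right]; rfl
  have hi' : Integrable fun x => fderiv ℝ φ x v := by
    simpa only [h1] using hi.const_inner (𝕜 := ℝ) v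
  have h := integral_mul_fderiv_eq_neg_fderiv_mul_of_integrable (μ := volume)
    (f := fun _ : Euc d => (1 : ℝ)) (g := φ) (v := v) (by simp) (by simpa using hi')
    (by simpa using hφ.continuous.integrable_of_hasCompactSupport hc) (by simp)
    (fun x _ => hφ.differentiable (by simp) x)
  simpa [h1] using h

theorem setIntegral_gradient_eq_zero {φ : Euc d → ℝ} (hφ : ContDiff ℝ ∞ φ)
    (hc : HasCompactSupport φ) (hU : tsupport φ ⊆ U) : ∫ x in U, gradient φ x = 0 := by
  rw [setIntegral_eq_integral_of_forall_compl_eq_zero, integral_gradient_eq_zero hφ hc]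
  intro x hx
  rw [gradient, image_eq_zero_of_notMem_tsupport fun h => hx (hU (tsupport_fderiv_subset ℝ h)),
    map_zero]

/-- Gradients of test functions integrate to zero, so `g` is orthogonal to all test functions and
the fundamental lemma of the calculus of variations applies. -/
theorem HasWeakGradient.ae_eq_zero_of_ae_eq_const (hU : IsOpen U) {u : Euc d → ℝ}
    {g : Euc d → Euc d} (hw : HasWeakGradient U u g) (hg : LocallyIntegrable g (volume.restrict U))
    {c : ℝ} (hu : u =ᵐ[volume.restrict U] fun _ => c) : g =ᵐ[volume.restrict U] 0 := by
  have h := hU.ae_eq_zero_of_integral_contDiff_smul_eq_zero (μ := volume.restrict U)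
    (f := g) (hg.locallyIntegrableOn U) fun φ hφ hc hφU => by
      have h1 := hw φ hφ hc hφU
      have h2 : ∫ x in U, u x • gradient φ x = 0 := by
        rw [integral_congr_ae (g := fun x => c • gradient φ x)
          (by filter_upwards [hu] with x hx; rw [hx]), integral_smul,
          setIntegral_gradient_eq_zero hφ hc hφU, smul_zero]
      rw [h2] at h1
      exact neg_eq_zero.1 h1.symm
  filter_upwards [h, ae_restrict_mem hU.measurableSet] with x hx hxU
  exact hx hxU

variable {P Q : ℝ≥0∞} [Fact (1 ≤ P)] [Fact (1 ≤ Q)]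

/-- For each test function, both sides of the weak gradient identity are pairings with an element of
`L^Q`, hence continuous on `L^P`. -/
theorem isClosed_sobolevSubmodule [ENNReal.HolderConjugate P Q] :
    IsClosed (sobolevSubmodule P U : Set (Lp ℝ P (volume.restrict U) ×
      Lp (Euc d) P (volume.restrict U))) := by
  have : (sobolevSubmodule P U : Set (Lp ℝ P (volume.restrict U) ×
      Lp (Euc d) P (volume.restrict U))) = ⋂ (φ : Euc d → ℝ) (_ : ContDiff ℝ ∞ φ)
        (_ : HasCompactSupport φ) (_ : tsupport φ ⊆ U),
        {v | ∫ x in U, v.1 x • gradient φ x = - ∫ x in U, φ x • v.2 x} := by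
    ext v
    simp only [mem_iInter]
    rfl
  rw [this]
  refine isClosed_iInter fun φ => isClosed_iInter fun hφ => isClosed_iInter fun hc =>
    isClosed_iInter fun hφU => ?_
  have m1 : MemLp (gradient φ) Q (volume.restrict U) :=
    ((continuous_gradient_of_contDiff hφ).memLp_of_hasCompactSupport hc.gradient).restrict U
  have m2 : MemLp φ Q (volume.restrict U) :=
    (hφ.continuous.memLp_of_hasCompactSupport hc).restrict U
  have c1 : Continuous fun u : Lp ℝ P (volume.restrict U) => ∫ x in U, u x • gradient φ x := by
    have h := (((ContinuousLinearMap.lsmul ℝ ℝ : ℝ →L[ℝ] Euc d →L[ℝ] Euc d).lpPairing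
      (volume.restrict U) P Q).flip (m1.toLp _)).continuous
    refine h.congr fun u => ?_
    rw [ContinuousLinearMap.flip_apply, ContinuousLinearMap.lpPairing_eq_integral]
    refine integral_congr_ae ?_
    filter_upwards [m1.coeFn_toLp] with x hx
    rw [hx, ContinuousLinearMap.lsmul_apply]
  have c2 : Continuous fun g : Lp (Euc d) P (volume.restrict U) => ∫ x in U, φ x • g x := by
    have h := (((ContinuousLinearMap.lsmul ℝ ℝ : ℝ →L[ℝ] Euc d →L[ℝ] Euc d).flip.lpPairing
      (volume.restrict U) P Q).flip (m2.toLp _)).continuous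
    refine h.congr fun u => ?_
    rw [ContinuousLinearMap.flip_apply, ContinuousLinearMap.lpPairing_eq_integral]
    refine integral_congr_ae ?_
    filter_upwards [m2.coeFn_toLp] with x hx
    rw [hx, ContinuousLinearMap.flip_apply, ContinuousLinearMap.lsmul_apply]
  exact isClosed_eq (c1.comp continuous_fst) (c2.comp continuous_snd).neg

theorem completeSpace_sobolev [ENNReal.HolderConjugate P Q] : CompleteSpace (Sobolev P U) :=
  (isClosed_sobolevSubmodule (P := P) (Q := Q) (U := U)).completeSpace_coe

namespace Sobolev

/-- The weak gradient as a continuous linear map. -/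
noncomputable def gradL (P : ℝ≥0∞) [Fact (1 ≤ P)] (U : Set (Euc d)) :
    Sobolev P U →L[ℝ] Lp (Euc d) P (volume.restrict U) :=
  (ContinuousLinearMap.snd ℝ (Lp ℝ P (volume.restrict U)) (Lp (Euc d) P (volume.restrict U))).comp
    (sobolevSubmodule P U).subtypeL

theorem gradL_apply (v : Sobolev P U) : gradL P U v = v.grad := rfl

theorem grad_eq_zero_of_fn_ae_eq_one (hU : IsOpen U) {v : Sobolev P U}
    (hv : v.fn =ᵐ[volume.restrict U] fun _ => (1 : ℝ)) : v.grad = 0 := by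
  have h : HasWeakGradient U v.fn v.grad := v.2
  refine Lp.ext ((h.ae_eq_zero_of_ae_eq_const hU ((Lp.memLp v.grad).locallyIntegrable Fact.out)
    hv).trans (Lp.coeFn_zero _ _ _).symm)

theorem isClosed_dualPerp : IsClosed (dualPerp Q U) := by
  have : dualPerp Q U = ⋂ (φ : Sobolev Q U) (_ : φ.fn =ᵐ[volume.restrict U] fun _ => (1 : ℝ)),
      {ν | ν φ = 0} := by
    ext ν; simp [dualPerp]
  rw [this]
  exact isClosed_iInter fun φ => isClosed_iInter fun _ =>
    isClosed_eq (ContinuousLinearMap.apply ℝ ℝ φ).continuous continuous_const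

variable [IsFiniteMeasure (volume.restrict U)]

/-- The integral over the domain as a continuous linear functional. -/
noncomputable def integralL (P Q : ℝ≥0∞) [Fact (1 ≤ P)] [Fact (1 ≤ Q)]
    [ENNReal.HolderConjugate P Q] (U : Set (Euc d)) [IsFiniteMeasure (volume.restrict U)] :
    Sobolev P U →L[ℝ] ℝ :=
  ((innerPairing (E := ℝ) (volume.restrict U) P Q).flip
      ((memLp_const (1 : ℝ)).toLp (fun _ => (1 : ℝ)))).comp
    ((ContinuousLinearMap.fst ℝ (Lp ℝ P (volume.restrict U))
      (Lp (Euc d) P (volume.restrict U))).comp (sobolevSubmodule P U).subtypeL)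

theorem integralL_apply [ENNReal.HolderConjugate P Q] (v : Sobolev P U) :
    integralL P Q U v = ∫ x in U, v.fn x := by
  change innerPairing (E := ℝ) (volume.restrict U) P Q v.fn _ = _
  rw [innerPairing_apply]
  refine integral_congr_ae ?_
  filter_upwards [(memLp_const (1 : ℝ) (p := Q) (μ := volume.restrict U)).coeFn_toLp] with x hx
  rw [hx]
  simp

/-- The constant function one. -/
noncomputable def one (P : ℝ≥0∞) [Fact (1 ≤ P)] (U : Set (Euc d))
    [IsFiniteMeasure (volume.restrict U)] : Sobolev P U :=
  ⟨((memLp_const (1 : ℝ)).toLp (fun _ => (1 : ℝ)), 0), by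
    intro φ hφ hc hφU
    have h1 : ∫ x in U, ((memLp_const (1 : ℝ) (p := P) (μ := volume.restrict U)).toLp
        (fun _ => (1 : ℝ))) x • gradient φ x = ∫ x in U, gradient φ x := by
      refine integral_congr_ae ?_
      filter_upwards [(memLp_const (1 : ℝ) (p := P) (μ := volume.restrict U)).coeFn_toLp] with x hx
      rw [hx, one_smul]
    have h2 : ∫ x in U, φ x • (0 : Lp (Euc d) P (volume.restrict U)) x = 0 := by
      refine integral_eq_zero_of_ae ?_
      filter_upwards [Lp.coeFn_zero (Euc d) P (volume.restrict U)] with x hx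
      simp only [hx, Pi.zero_apply, smul_zero]
    simp only [h1, h2, setIntegral_gradient_eq_zero hφ hc hφU, neg_zero]⟩

theorem one_fn : (one P U).fn =ᵐ[volume.restrict U] fun _ => (1 : ℝ) :=
  (memLp_const (1 : ℝ)).coeFn_toLp

theorem exists_isMeanZero_sub_smul_one [ENNReal.HolderConjugate P Q] (hU : IsOpen U)
    (hne : U.Nonempty) (φ : Sobolev P U) : ∃ c : ℝ, (φ - c • one P U).IsMeanZero := by
  have hvol : ∫ x in U, (one P U).fn x ≠ 0 := by
    rw [integral_congr_ae one_fn]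
    have h1 : 0 < volume U := hU.measure_pos volume hne
    have h2 : volume U ≠ ⊤ := by simpa using measure_ne_top (volume.restrict U) univ
    simpa [measureReal_def] using (ENNReal.toReal_pos h1.ne' h2).ne'
  refine ⟨(integralL P Q U φ) / (integralL P Q U (one P U)), ?_⟩
  rw [← integralL_apply (Q := Q)] at hvol
  rw [IsMeanZero, ← integralL_apply (Q := Q), map_sub, map_smul, smul_eq_mul,
    div_mul_cancel₀ _ hvol, sub_self]

/-- Subtracting a constant makes any function mean-zero and does not affect these functionals. This
matters because the Neumann problem is tested on mean-zero functions only. -/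
theorem ext_of_mem_dualPerp [ENNReal.HolderConjugate P Q] (hU : IsOpen U) (hne : U.Nonempty)
    {ν ν' : StrongDual ℝ (Sobolev Q U)} (hν : ν ∈ dualPerp Q U) (hν' : ν' ∈ dualPerp Q U)
    (h : ∀ ψ : Sobolev Q U, ψ.IsMeanZero → ν ψ = ν' ψ) : ν = ν' := by
  have : ENNReal.HolderConjugate Q P := ENNReal.HolderConjugate.symm
  refine ContinuousLinearMap.ext fun φ => ?_
  obtain ⟨c, h0⟩ := exists_isMeanZero_sub_smul_one (P := Q) (Q := P) hU hne φ
  have key : ∀ ν ∈ dualPerp Q U, ν φ = ν (φ - c • one Q U) := fun ν hν => by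
    have h1 : ν (c • one Q U) = 0 := by
      rw [ν.map_smul, hν _ one_fn, smul_zero]
    rw [ν.map_sub, h1, sub_zero]
  rw [key ν hν, key ν' hν', h _ h0]

/-- Unique solvability of the Neumann-Poisson problem implies the Poincaré inequality. -/
theorem exists_norm_fn_le_mul_norm_grad [ENNReal.HolderConjugate P Q] (hU : IsOpen U)
    (hne : U.Nonempty)
    (hsolv : ∀ ν ∈ dualPerp Q U, ∃! y : Sobolev P U, y.IsMeanZero ∧
      ∀ φ : Sobolev Q U, φ.IsMeanZero → - ∫ x in U, inner ℝ (y.grad x) (φ.grad x) = ν φ) :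
    ∃ C : ℝ, 0 ≤ C ∧ ∀ y : Sobolev P U, y.IsMeanZero → ‖y.fn‖ ≤ C * ‖y.grad‖ := by
  have : ENNReal.HolderConjugate Q P := ENNReal.HolderConjugate.symm
  have := completeSpace_sobolev (P := P) (Q := Q) (U := U)
  have hmem : ∀ y : Sobolev P U, integralL P Q U y = 0 ↔ y.IsMeanZero := fun y => by
    rw [integralL_apply, IsMeanZero]
  -- `S` is the weak divergence, and `S` after the gradient is the Neumann Laplacian. This
  -- factorization is why the final bound involves the gradient alone.
  obtain ⟨S, hSapp⟩ : ∃ S : Lp (Euc d) P (volume.restrict U) →L[ℝ] StrongDual ℝ (Sobolev Q U),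
      ∀ g φ, S g φ = -∫ x in U, inner ℝ (g x) (φ.grad x) :=
    ⟨(ContinuousLinearMap.precomp ℝ (gradL Q U)).comp (-innerPairing (volume.restrict U) P Q),
      fun g φ => by rw [← innerPairing_apply]; rfl⟩
  have hperp : ∀ g : Lp (Euc d) P (volume.restrict U), S g ∈ dualPerp Q U := fun g φ hφ => by
    have : φ.grad = 0 := grad_eq_zero_of_fn_ae_eq_one hU hφ
    rw [hSapp, this, ← innerPairing_apply (P := P) (Q := Q), map_zero, neg_zero]
  have hinj : ∀ y y' : Sobolev P U, integralL P Q U y = 0 → integralL P Q U y' = 0 →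
      S (gradL P U y) = S (gradL P U y') → y = y' := by
    intro y y' hy hy' h
    obtain ⟨z, -, hz⟩ := hsolv (S y.grad) (hperp _)
    have h1 := hz y ⟨(hmem _).1 hy, fun φ _ => (hSapp _ φ).symm⟩
    have h' : S y.grad = S y'.grad := h
    have h2 := hz y' ⟨(hmem _).1 hy', fun φ _ => by rw [h']; exact (hSapp _ φ).symm⟩
    exact h1.trans h2.symm
  have hsurj : ∀ ν ∈ dualPerp Q U, ∃ y, integralL P Q U y = 0 ∧ S (gradL P U y) = ν := by
    intro ν hν
    obtain ⟨y, ⟨hy0, hy⟩, -⟩ := hsolv ν hν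
    refine ⟨y, (hmem y).2 hy0, ?_⟩
    rw [gradL_apply]
    exact ext_of_mem_dualPerp (P := P) hU hne (hperp _) hν fun ψ h0 => (hSapp _ ψ).trans (hy ψ h0)
  obtain ⟨C, hC, h⟩ := ContinuousLinearMap.exists_norm_le_mul_norm_of_injOn_ker
    (integralL P Q U) (gradL P U) S isClosed_dualPerp hinj hperp hsurj
  exact ⟨C, hC, fun y hy => (le_max_left _ _).trans (h y ((hmem y).2 hy))⟩

end Sobolev

end SobolevSpace

/-- The bound forces `c` to vanish on `ker γ`, so it descends to a bounded functional on the range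
of `γ`, which Hahn–Banach extends to `G`. -/
theorem LinearMap.exists_strongDual_comp_eq {V G : Type*} [AddCommGroup V] [Module ℝ V]
    [NormedAddCommGroup G] [NormedSpace ℝ G] (γ : V →ₗ[ℝ] G) (c : V →ₗ[ℝ] ℝ) {C : ℝ}
    (h : ∀ v, |c v| ≤ C * ‖γ v‖) : ∃ L : StrongDual ℝ G, ∀ v, L (γ v) = c v := by
  have hker : LinearMap.ker γ ≤ LinearMap.ker c := fun v hv => by
    have h1 := h v
    rw [LinearMap.mem_ker.1 hv, norm_zero, mul_zero] at h1
    exact abs_eq_zero.1 (le_antisymm h1 (abs_nonneg _))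
  set c' : LinearMap.range γ →ₗ[ℝ] ℝ :=
    ((LinearMap.ker γ).liftQ c hker).comp γ.quotKerEquivRange.symm.toLinearMap with hc'
  have hc'v : ∀ v, c' ⟨γ v, LinearMap.mem_range_self γ v⟩ = c v := fun v => by
    have h1 : γ.quotKerEquivRange.symm ⟨γ v, LinearMap.mem_range_self γ v⟩ =
        (LinearMap.ker γ).mkQ v := by
      rw [LinearEquiv.symm_apply_eq]
      exact Subtype.ext (γ.quotKerEquivRange_apply_mk v).symm
    rw [hc', LinearMap.comp_apply, LinearEquiv.coe_coe, h1]
    exact Submodule.liftQ_apply _ _ _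
  have hbound : ∀ y, ‖c' y‖ ≤ C * ‖y‖ := by
    rintro ⟨_, v, rfl⟩
    rw [hc'v]
    exact h v
  obtain ⟨L, hL, -⟩ := exists_extension_norm_eq (LinearMap.range γ)
    (c'.mkContinuous C hbound)
  exact ⟨L, fun v => (hL ⟨γ v, LinearMap.mem_range_self γ v⟩).trans (hc'v v)⟩

/-! ### Fields on a set tested on a subset -/

section Restriction

variable {X E : Type*} [MeasurableSpace X] [NormedAddCommGroup E]
  {μ : Measure X} {s t : Set X} {P Q : ℝ≥0∞}

theorem memLp_indicator_restrict (hs : MeasurableSet s) (hst : s ⊆ t) {g : X → E}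
    (hg : MemLp g P (μ.restrict s)) : MemLp (s.indicator g) P (μ.restrict t) := by
  rwa [memLp_indicator_iff_restrict hs, Measure.restrict_restrict_of_subset hst]

/-- Extending `g` by zero turns the integral over `s` into a pairing over `t`. Below, `s` is the
interior of `t = Ω`, and nothing about the measure of the boundary is needed. -/
theorem exists_continuousLinearMap_eq_setIntegral_inner [InnerProductSpace ℝ E] [Fact (1 ≤ P)]
    [Fact (1 ≤ Q)] [ENNReal.HolderConjugate P Q] (hs : MeasurableSet s) (hst : s ⊆ t)
    (g : Lp E Q (μ.restrict s)) :
    ∃ Λ : Lp E P (μ.restrict t) →L[ℝ] ℝ, ∀ q, Λ q = ∫ x in s, inner ℝ (q x) (g x) ∂μ := by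
  have hg := memLp_indicator_restrict hs hst (Lp.memLp g)
  refine ⟨(innerPairing (μ.restrict t) P Q).flip (hg.toLp _), fun q => ?_⟩
  rw [ContinuousLinearMap.flip_apply, innerPairing_apply]
  have h1 : ∫ x in t, inner ℝ (q x) (hg.toLp _ x) ∂μ =
      ∫ x in t, s.indicator (fun x => inner ℝ (q x) (g x)) x ∂μ := by
    refine integral_congr_ae ?_
    filter_upwards [hg.coeFn_toLp] with x hx
    rw [hx]
    by_cases h : x ∈ s
    · rw [indicator_of_mem h, indicator_of_mem h]
    · rw [indicator_of_notMem h, indicator_of_notMem h, inner_zero_right]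
  rw [h1, setIntegral_indicator hs, inter_eq_self_of_subset_right hst]

end Restriction

/-! ### The weighted transport term -/

section WeightedNorm

variable {X E : Type*} [MeasurableSpace X] [NormedAddCommGroup E] {μ : Measure X} {p q : ℝ}
  {w : X → ℝ}

theorem integrable_mul_norm_Lp (hpq : p.HolderConjugate q) (hw : MemLp w (ENNReal.ofReal q) μ)
    (f : Lp E (ENNReal.ofReal p) μ) : Integrable (fun x => w x * ‖f x‖) μ := by
  have : ENNReal.HolderConjugate (ENNReal.ofReal q) (ENNReal.ofReal p) := hpq.symm.ennrealOfReal
  exact hw.integrable_mul (Lp.memLp f).norm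

/-- The reverse triangle inequality and Hölder give the Lipschitz constant `‖w‖_q`. -/
theorem continuous_integral_mul_norm (hpq : p.HolderConjugate q) [Fact (1 ≤ ENNReal.ofReal p)]
    (hw : MemLp w (ENNReal.ofReal q) μ) :
    Continuous fun f : Lp E (ENNReal.ofReal p) μ => ∫ x, w x * ‖f x‖ ∂μ := by
  have hp0 : 0 < p := hpq.pos
  set B := (∫ x, ‖w x‖ ^ q ∂μ) ^ (1 / q) with hB
  refine (LipschitzWith.of_dist_le_mul (K := B.toNNReal) fun f g => ?_).continuous
  have hB0 : 0 ≤ B := Real.rpow_nonneg (integral_nonneg fun _ => by positivity) _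
  rw [Real.coe_toNNReal _ hB0, dist_eq_norm, dist_eq_norm,
    ← integral_sub (integrable_mul_norm_Lp hpq hw f) (integrable_mul_norm_Lp hpq hw g)]
  have hnorm : (∫ x, ‖(f - g) x‖ ^ p ∂μ) ^ (1 / p) = ‖f - g‖ := by
    rw [← Lp_norm_rpow_eq_integral hp0, ← Real.rpow_mul (norm_nonneg _),
      mul_one_div_cancel hp0.ne', Real.rpow_one]
  have hint : Integrable (fun x => ‖w x‖ * ‖(f - g) x‖) μ :=
    integrable_mul_norm_Lp hpq hw.norm (f - g)
  calc ‖∫ x, w x * ‖f x‖ - w x * ‖g x‖ ∂μ‖ ≤ ∫ x, ‖w x‖ * ‖(f - g) x‖ ∂μ := by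
        refine norm_integral_le_of_norm_le hint ?_
        filter_upwards [Lp.coeFn_sub f g] with x hx
        rw [hx, Pi.sub_apply, ← mul_sub, norm_mul]
        exact mul_le_mul_of_nonneg_left (abs_norm_sub_norm_le _ _) (norm_nonneg _)
    _ = ∫ x, ‖w x‖ * ‖‖(f - g) x‖‖ ∂μ := by simp only [norm_norm]
    _ ≤ B * (∫ x, ‖‖(f - g) x‖‖ ^ p ∂μ) ^ (1 / p) :=
        integral_mul_norm_le_Lp_mul_Lq hpq.symm hw (Lp.memLp (f - g)).norm
    _ = B * ‖f - g‖ := by simp only [norm_norm, hnorm]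

theorem integral_mul_norm_midpoint_le [NormedSpace ℝ E] (hpq : p.HolderConjugate q)
    [Fact (1 ≤ ENNReal.ofReal p)] (hw : MemLp w (ENNReal.ofReal q) μ) (hw0 : ∀ᵐ x ∂μ, 0 ≤ w x)
    (f g : Lp E (ENNReal.ofReal p) μ) :
    ∫ x, w x * ‖((2⁻¹ : ℝ) • (f + g)) x‖ ∂μ ≤
      (∫ x, w x * ‖f x‖ ∂μ + ∫ x, w x * ‖g x‖ ∂μ) / 2 := by
  have i1 := integrable_mul_norm_Lp hpq hw f
  have i2 := integrable_mul_norm_Lp hpq hw g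
  rw [← integral_add i1 i2, ← integral_div]
  refine integral_mono_ae (integrable_mul_norm_Lp hpq hw _) ((i1.add i2).div_const 2) ?_
  filter_upwards [hw0, Lp.coeFn_smul (2⁻¹ : ℝ) (f + g), Lp.coeFn_add f g] with x h0 h1 h2
  rw [h1, Pi.smul_apply, h2, Pi.add_apply, norm_smul]
  have h3 := mul_le_mul_of_nonneg_left (norm_add_le (f x) (g x)) h0
  norm_num
  linarith

end WeightedNorm

theorem abs_setIntegral_le_of_forall_abs_le {X : Type*} [MeasurableSpace X] {μ : Measure X}
    [IsProbabilityMeasure μ] {s : Set X} {f : X → ℝ} {M : ℝ} (hM : 0 ≤ M)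
    (h : ∀ x ∈ s, |f x| ≤ M) : |∫ x in s, f x ∂μ| ≤ M := by
  have h1 := norm_setIntegral_le_of_norm_le_const (f := f) (measure_lt_top μ s) h
  exact h1.trans (mul_le_of_le_one_right hM measureReal_le_one)

/-! ### Feasibility and the main theorem -/

section Beckmann

variable {d : ℕ} {Ω : Set (Euc d)} {α : ℝ} [Fact (1 < α)]

theorem isFiniteMeasure_restrict_interior (hΩ : IsCompact Ω) :
    IsFiniteMeasure (volume.restrict (interior Ω)) :=
  ⟨by simpa using (measure_mono interior_subset).trans_lt hΩ.measure_lt_top⟩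

theorem isClosed_setOf_hasDivergence (μp μm : Measure (Euc d)) :
    IsClosed {q : LpField Ω α | HasDivergence q μp μm} := by
  have hpq := Real.HolderConjugate.conjExponent (Fact.out : 1 < α)
  have : ENNReal.HolderConjugate (ENNReal.ofReal α) (ENNReal.ofReal α.conjExponent) :=
    hpq.ennrealOfReal
  simp only [HasDivergence, ofPred_forall]
  refine isClosed_iInter fun φ => isClosed_iInter fun _ => isClosed_iInter fun f =>
    isClosed_iInter fun _ => isClosed_iInter fun _ => ?_
  obtain ⟨Λ, hΛ⟩ := exists_continuousLinearMap_eq_setIntegral_inner (μ := volume)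
    (P := ENNReal.ofReal α) (isOpen_interior (s := Ω)).measurableSet interior_subset φ.grad
  simp only [← hΛ]
  exact isClosed_eq Λ.continuous.neg continuous_const

theorem HasDivergence.midpoint {μp μm : Measure (Euc d)} {q q' : LpField Ω α}
    (hq : HasDivergence q μp μm) (hq' : HasDivergence q' μp μm) :
    HasDivergence ((2⁻¹ : ℝ) • (q + q')) μp μm := by
  have hpq := Real.HolderConjugate.conjExponent (Fact.out : 1 < α)
  have : ENNReal.HolderConjugate (ENNReal.ofReal α) (ENNReal.ofReal α.conjExponent) :=
    hpq.ennrealOfReal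
  intro φ hφ f hf hφf
  obtain ⟨Λ, hΛ⟩ := exists_continuousLinearMap_eq_setIntegral_inner (μ := volume)
    (P := ENNReal.ofReal α) (isOpen_interior (s := Ω)).measurableSet interior_subset φ.grad
  have h1 := hq φ hφ f hf hφf
  have h2 := hq' φ hφ f hf hφf
  rw [← hΛ] at h1 h2 ⊢
  rw [map_smul, map_add, smul_eq_mul]
  linarith

/-- The pairs of a mean-zero Sobolev function and a representative that is continuous up to the
boundary. -/
noncomputable def continuousRepresentatives (P Q : ℝ≥0∞) [Fact (1 ≤ P)] [Fact (1 ≤ Q)]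
    [ENNReal.HolderConjugate P Q] (Ω : Set (Euc d))
    [IsFiniteMeasure (volume.restrict (interior Ω))] :
    Submodule ℝ (Sobolev P (interior Ω) × (Euc d → ℝ)) where
  carrier := {v | Sobolev.integralL P Q (interior Ω) v.1 = 0 ∧ ContinuousOn v.2 Ω ∧
    v.1.fn =ᵐ[volume.restrict (interior Ω)] v.2}
  zero_mem' := ⟨map_zero _, continuousOn_const, Lp.coeFn_zero _ _ _⟩
  add_mem' := by
    rintro v v' ⟨h1, h2, h3⟩ ⟨h1', h2', h3'⟩
    refine ⟨by rw [Prod.fst_add, map_add, h1, h1', add_zero], h2.add h2', ?_⟩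
    exact (Lp.coeFn_add v.1.fn v'.1.fn).trans (h3.add h3')
  smul_mem' := by
    rintro c v ⟨h1, h2, h3⟩
    refine ⟨by rw [Prod.smul_fst, map_smul, h1, smul_zero], h2.const_smul c, ?_⟩
    exact (Lp.coeFn_smul c v.1.fn).trans (h3.const_smul c)

/-- Morrey and Poincaré bound the mass functional by the norm of the gradient; Hahn–Banach and `L^p`
duality turn this bound into a field. -/
theorem exists_hasDivergence (hΩ : IsCompact Ω) (hcl : closure (interior Ω) = Ω)
    (hlip : IsLipschitzDomain (interior Ω)) (hd : (d : ℝ) < α.conjExponent)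
    (μp μm : Measure (Euc d)) [IsProbabilityMeasure μp] [IsProbabilityMeasure μm]
    (hsolv : NeumannPoissonSolvable Ω α) : ∃ q : LpField Ω α, HasDivergence q μp μm := by
  have hpq := (Real.HolderConjugate.conjExponent (Fact.out : 1 < α)).symm
  have hfin := isFiniteMeasure_restrict_interior hΩ
  set p := α.conjExponent with hp
  set U := interior Ω with hU
  have hp0 : 0 < p := hpq.pos
  have : ENNReal.HolderConjugate (ENNReal.ofReal p) (ENNReal.ofReal α) := hpq.ennrealOfReal
  obtain ⟨C₁, hC₁, hsup⟩ := hlip.exists_forall_abs_le (hcl.symm ▸ hΩ) hpq hd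
  obtain ⟨C₂, hC₂, hpoin⟩ := Sobolev.exists_norm_fn_le_mul_norm_grad (P := ENNReal.ofReal p)
    (Q := ENNReal.ofReal α) (U := U) isOpen_interior hlip.isConnected.nonempty hsolv
  -- Carrying the representative along makes integration against `μp` and `μm` linear without first
  -- showing that every Sobolev function has a continuous representative.
  set V := continuousRepresentatives (ENNReal.ofReal p) (ENNReal.ofReal α) Ω with hV
  let γ : V →ₗ[ℝ] Lp (Euc d) (ENNReal.ofReal p) (volume.restrict U) :=
    (Sobolev.gradL (ENNReal.ofReal p) U).toLinearMap ∘ₗ LinearMap.fst ℝ _ _ ∘ₗ V.subtype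
  have hint : ∀ (v : V) (μ : Measure (Euc d)) [IsProbabilityMeasure μ],
      IntegrableOn v.1.2 Ω μ := fun v μ _ => v.2.2.1.integrableOn_compact hΩ
  -- The order `μm` minus `μp` absorbs the minus sign in the divergence constraint.
  let c : V →ₗ[ℝ] ℝ :=
    { toFun := fun v => (∫ x in Ω, v.1.2 x ∂μm) - ∫ x in Ω, v.1.2 x ∂μp
      map_add' := fun v v' => by
        have h1 := integral_add (hint v μm) (hint v' μm)
        have h2 := integral_add (hint v μp) (hint v' μp)
        simp only [Submodule.coe_add, Prod.snd_add, Pi.add_apply] at h1 h2 ⊢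
        rw [h1, h2]
        ring
      map_smul' := fun a v => by
        simp only [Submodule.coe_smul, Prod.smul_snd, Pi.smul_apply, smul_eq_mul,
          integral_const_mul, RingHom.id_apply]
        ring }
  -- `C₁` comes from Morrey and `C₂` from Poincaré; the factor `2` counts the two probability
  -- measures.
  have hc : ∀ v, |c v| ≤ 2 * (C₁ * (C₂ + 1)) * ‖γ v‖ := by
    intro v
    obtain ⟨⟨φ, f⟩, hφ, hf, hφf⟩ := v
    have hw : HasWeakGradient U f φ.grad := fun ψ hψ hψc hψU => by
      refine Eq.trans (integral_congr_ae ?_) (φ.2 ψ hψ hψc hψU)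
      filter_upwards [hφf] with x hx
      rw [← hx]
      rfl
    have hfp : MemLp f (ENNReal.ofReal p) (volume.restrict U) :=
      (memLp_congr_ae hφf).1 (Lp.memLp φ.fn)
    have h1 : (∫ z in U, ‖f z‖ ^ p) ^ (1 / p) = ‖φ.fn‖ := by
      have : ∫ z in U, ‖f z‖ ^ p = ‖φ.fn‖ ^ p := by
        rw [Lp_norm_rpow_eq_integral hp0]
        refine integral_congr_ae ?_
        filter_upwards [hφf] with x hx
        rw [hx]
      rw [this, ← Real.rpow_mul (norm_nonneg _), mul_one_div_cancel hp0.ne', Real.rpow_one]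
    have h2 : (∫ z in U, ‖φ.grad z‖ ^ p) ^ (1 / p) = ‖φ.grad‖ := by
      rw [← Lp_norm_rpow_eq_integral hp0, ← Real.rpow_mul (norm_nonneg _),
        mul_one_div_cancel hp0.ne', Real.rpow_one]
    have hmz : φ.IsMeanZero := by
      rw [Sobolev.IsMeanZero, ← Sobolev.integralL_apply (Q := ENNReal.ofReal α)]
      exact hφ
    have h3 : ∀ x ∈ Ω, |f x| ≤ C₁ * ((C₂ + 1) * ‖φ.grad‖) := fun x hx => by
      have h4 := hsup f φ.grad hw hfp (Lp.memLp φ.grad) (hcl.symm ▸ hf) x (hcl.symm ▸ hx)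
      rw [h1, h2] at h4
      refine h4.trans (mul_le_mul_of_nonneg_left ?_ hC₁)
      linarith [hpoin φ hmz]
    have h0 : 0 ≤ C₁ * ((C₂ + 1) * ‖φ.grad‖) := by positivity
    have h5 := abs_setIntegral_le_of_forall_abs_le (μ := μm) h0 h3
    have h6 := abs_setIntegral_le_of_forall_abs_le (μ := μp) h0 h3
    change |(∫ x in Ω, f x ∂μm) - ∫ x in Ω, f x ∂μp| ≤ 2 * (C₁ * (C₂ + 1)) * ‖φ.grad‖
    have h7 := abs_sub (∫ x in Ω, f x ∂μm) (∫ x in Ω, f x ∂μp)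
    linarith
  obtain ⟨L, hL⟩ := LinearMap.exists_strongDual_comp_eq (V := V) γ c hc
  obtain ⟨q₀, hq₀⟩ := exists_Lp_forall_eq_integral_inner hpq L
  have hq := memLp_indicator_restrict (isOpen_interior (s := Ω)).measurableSet interior_subset
    (Lp.memLp q₀)
  -- The representing field lives on the interior and is extended by zero to `Ω`.
  refine ⟨hq.toLp _, fun φ hφ f hf hφf => ?_⟩
  have hv : ((φ, f) : Sobolev (ENNReal.ofReal p) U × (Euc d → ℝ)) ∈ V :=
    ⟨by rw [Sobolev.integralL_apply]; exact hφ, hf, hφf⟩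
  have h1 : L φ.grad = (∫ x in Ω, f x ∂μm) - ∫ x in Ω, f x ∂μp := hL ⟨_, hv⟩
  have h2 : ∫ x in U, inner ℝ (hq.toLp _ x) (φ.grad x) = L φ.grad := by
    rw [hq₀]
    refine integral_congr_ae ?_
    filter_upwards [ae_mono (Measure.restrict_mono_set volume interior_subset) hq.coeFn_toLp,
      ae_restrict_mem (isOpen_interior (s := Ω)).measurableSet] with x hx hxU
    rw [hx, indicator_of_mem hxU]
  rw [h2, h1]
  ring

end Beckmann

/-- For `d ≥ 2`, `α < d / (d - 1)` rearranges to `d < α / (α - 1)`; for `d = 1` the claim is that a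
conjugate exponent exceeds one. -/
theorem natCast_lt_conjExponent {d : ℕ} (hd : 1 ≤ d) {α : ℝ} (hα1 : 1 < α)
    (hα : 2 ≤ d → α < (d : ℝ) / ((d : ℝ) - 1)) : (d : ℝ) < α.conjExponent := by
  rcases hd.eq_or_lt with rfl | h
  · simpa using (Real.HolderConjugate.conjExponent hα1).symm.lt
  · have h1 := hα h
    have h2 : (1 : ℝ) < d := by exact_mod_cast h
    rw [lt_div_iff₀ (by linarith)] at h1
    rw [Real.conjExponent, lt_div_iff₀ (by linarith)]
    linarith

theorem mainTheorem1 (d : ℕ) (hd : 1 ≤ d)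
    (Ω : Set (Euc d)) (hΩ : IsCompact Ω) (hΩ_closure : closure (interior Ω) = Ω)
    (hΩ_lip : IsLipschitzDomain (interior Ω))
    (w : Euc d → ℝ) (hw : ContinuousOn w Ω) (hw_nonneg : ∀ x ∈ Ω, 0 ≤ w x)
    (α : ℝ) [hα1 : Fact (1 < α)] (hα : 2 ≤ d → α < (d : ℝ) / ((d : ℝ) - 1))
    (μp μm : Measure (Euc d)) [IsProbabilityMeasure μp] [IsProbabilityMeasure μm]
    (hμp : μp Ωᶜ = 0) (hμm : μm Ωᶜ = 0)
    (hPoisson : NeumannPoissonSolvable Ω α)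
    (ε : ℝ) (hε : 0 < ε) :
    ∃! q : LpField Ω α, IsBeckmannSolution w ε μp μm q := by
  have hpq := Real.HolderConjugate.conjExponent hα1.out
  have hα0 : 0 < α := hpq.pos
  have hfin : IsFiniteMeasure (volume.restrict Ω) := ⟨by simpa using hΩ.measure_lt_top⟩
  have hwp : MemLp w (ENNReal.ofReal α.conjExponent) (volume.restrict Ω) := by
    obtain ⟨W, hW⟩ := hΩ.exists_bound_of_continuousOn hw
    exact MemLp.of_bound (hw.aestronglyMeasurable hΩ.measurableSet) W
      ((ae_restrict_iff' hΩ.measurableSet).2 (Eventually.of_forall hW))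
  have hw0 : ∀ᵐ x ∂volume.restrict Ω, 0 ≤ w x :=
    (ae_restrict_iff' hΩ.measurableSet).2 (Eventually.of_forall hw_nonneg)
  -- The transport term is nonnegative, so the linear lower bound holds with `B = 0`, and `ε > 0`
  -- supplies the uniformly convex part.
  exact existsUnique_minimizer_of_uniformlyConvexPow (E := LpField Ω α) hα1.out
    ((uniformlyConvexPow_of_strictConvexSpace hα1.out).lp hα0)
    (isClosed_setOf_hasDivergence μp μm)
    (exists_hasDivergence hΩ hΩ_closure hΩ_lip (natCast_lt_conjExponent hd hα1.out hα) μp μm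
      hPoisson)
    (fun u hu v hv => HasDivergence.midpoint hu hv)
    (F := fun q => ∫ x in Ω, w x * ‖q x‖) (continuous_integral_mul_norm hpq hwp)
    (integral_mul_norm_midpoint_le hpq hwp hw0) (B := 0)
    (fun u => by
      rw [zero_mul, neg_zero]
      exact integral_nonneg_of_ae (hw0.mono fun x hx => mul_nonneg hx (norm_nonneg _)))
    (c := ε / α) (by positivity)
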